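/- Let $0<\alpha<1$. For real $z,\beta$ and $\rho>-1$ let $W(z,\rho,\beta)=\sum_{k\ge 0}\frac{z^k}{k!\,\Gamma(\rho k+\beta)}$ be the Wright function (with $1/\Gamma=0$ at the poles of $\Gamma$), and let $${}^{RL}_{0}D^{1-\alpha}_t f(t)=\frac{1}{\Gamma(\alpha)}\frac{d}{dt}\int_0^t (t-\tau)^{\alpha-1}f(\tau)\,d\tau$$ be the Riemann--Liouville derivative of order $1-\alpha$. For $T>0$ consider the fractional Stefan problem $$(i)\quad u_t(x,t)=\frac{\partial}{\partial x}\Big({}^{RL}_{0}D^{1-\alpha}_t u_x(x,t)\Big),\quad 0<x<s(t),\ 0<t<T;$$ $$(ii)\quad u(0,t)=1,\quad 0<t\le T;\qquad (iii)\quad u(s(t),t)=0,\quad 0<t\le T,\quad s(0)=0;$$ $$(iv)\quad s'(t)=-\,{}^{RL}_{0}D^{1-\alpha}_t u_x(x,t)\Big|_{(s(t),t)},\quad 0<t\le T,$$ where in $(iv)$ the fractional derivative in time is taken for fixed $x$ and then evaluated at $x=s(t)$; time derivatives at $t=T$ are left derivatives. Put $\Omega_T=\{(x,t):0<x<s(t),\,0<t\le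 T\}$, let $\partial_p\Omega_T$ be the union of $\{(0,t):0<t\le T\}$, $\{(s(t),t):0<t\le T\}$ and $\{(0,0)\}$, and let $b_0=\max_{[0,T]}s$. A pair $\{u,s\}$ is a solution of this problem if: 1. $s\in C[0,T]\cap C^1(0,T)$; 2. $u_x$ exists on $[0,b_0]\times(0,T]$ (one-sidedly at $x=0$ and $x=b_0$), and $u,u_x,u_{xx}$ exist and are continuous in $\Omega_T$; 3. $u_x(x,\cdot)\in L^1(0,T)$ for every $x\in[0,b_0]$; $u_x(x,\cdot)$ is absolutely continuous on $(0,T)$ for every $x\in(0,b_0]$, and $u_x(0,\cdot)$ is absolutely continuous on every compact subinterval of $(0,T)$; 4. $u$ is continuous on $\Omega_T\cup\partial_p\Omega_T$ except perhaps at $(0,0)$, where $0\le\liminf u\le\limsup u<+\infty$ (limits at $(0,0)$ within $\Omega_T\cup\partial_p\Omega_T$); 5. ${}^{RL}_{0}D^{1-\alpha}_t u_x(x,t)$ exists in $\Omega_T$ and at $(s(t),t)$ for all $t\in(0,T]$; 6. $(i)$--$(iv)$ hold (all derivatives that occur in them exist). Then the equation $$2x\left[1-W\left(-2x,-\tfrac{\alpha}{2},1\right)\right]=2x\,W\left(-2x,-\tfrac{\alpha}{2},1\right)+W\left(-2x,-\tfrac{\alpha}{2},1+\tfrac{\alpha}{2}\right),\qquad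 x>0,$$ has a unique solution $\xi$, and for every $T>0$ the pair $$u(x,t)=1-\frac{1-W\left(-\frac{x}{t^{\alpha/2}},-\frac{\alpha}{2},1\right)}{1-W\left(-2\xi,-\frac{\alpha}{2},1\right)},\qquad s(t)=2\xi\,t^{\alpha/2}$$ is a solution of the fractional Stefan problem $(i)$--$(iv)$. -/

import Mathlib

open Set Filter Topology MeasureTheory

noncomputable section

/-- The Wright function `W(z; ρ; β) = ∑ₖ zᵏ / (k! Γ(ρ k + β))` for real arguments, `ρ > -1`.
At the poles of `Γ` Mathlib has `Γ = 0` and `a / 0 = 0`, so that the corresponding terms vanish,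
in accordance with `1 / Γ = 0` there. -/
def wright (z ρ β : ℝ) : ℝ :=
  ∑' k : ℕ, z ^ k / ((k.factorial : ℝ) * Real.Gamma (ρ * (k : ℝ) + β))

/-- Riemann--Liouville integral `₀I^β f (t)`. -/
def rlIntegral (β : ℝ) (f : ℝ → ℝ) (t : ℝ) : ℝ :=
  1 / Real.Gamma β * ∫ τ in (0 : ℝ)..t, (t - τ) ^ (β - 1) * f τ

/-- Riemann--Liouville derivative `ᴿᴸ₀D^γ f (t)` of order `γ ∈ (0, 1)` of a function on `(0, T)`:
the derivative of the integral of order `1 - γ`. It is taken within `[0, T]`, so it is the usual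
two-sided derivative for `0 < t < T` and the left derivative at `t = T`. -/
def rlDeriv (T γ : ℝ) (f : ℝ → ℝ) (t : ℝ) : ℝ :=
  derivWithin (rlIntegral (1 - γ) f) (Icc 0 T) t

/-- Existence of the Riemann--Liouville derivative of order `γ ∈ (0, 1)` at `t ∈ (0, T]`: the
integrals of order `1 - γ` converge on `(0, T]` and are differentiable at `t` as a function of the
upper limit. -/
def RLDifferentiableAt (T γ : ℝ) (f : ℝ → ℝ) (t : ℝ) : Prop :=
  (∀ r ∈ Ioc 0 T, IntervalIntegrable (fun τ => (r - τ) ^ (1 - γ - 1) * f τ) volume 0 r) ∧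
    DifferentiableWithinAt ℝ (rlIntegral (1 - γ) f) (Icc 0 T) t

/-- `f` is absolutely continuous on the bounded open interval `(a, b)`; equivalently, it extends to
an absolutely continuous function on `[a, b]`. -/
def ACOpenInterval (f : ℝ → ℝ) (a b : ℝ) : Prop :=
  ∃ g : ℝ → ℝ, AbsolutelyContinuousOnInterval g a b ∧ EqOn g f (Ioo a b)

/-- `f` is locally absolutely continuous on `(a, b)`: absolutely continuous on every compact
subinterval. -/
def ACLocOpenInterval (f : ℝ → ℝ) (a b : ℝ) : Prop :=
  ∀ c d : ℝ, a < c → c < d → d < b → AbsolutelyContinuousOnInterval f c d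

/-- `b₀ = max {s(t) : 0 ≤ t ≤ T}`. -/
def frontMax (s : ℝ → ℝ) (T : ℝ) : ℝ := sSup (s '' Icc 0 T)

/-- The region `Ω_T = {(x, t) : 0 < x < s(t), 0 < t ≤ T}`. -/
def stefanRegion (s : ℝ → ℝ) (T : ℝ) : Set (ℝ × ℝ) :=
  {p | 0 < p.1 ∧ p.1 < s p.2 ∧ 0 < p.2 ∧ p.2 ≤ T}

/-- The parabolic boundary of `Ω_T`, with `b = s(0)`. -/
def stefanParabolicBoundary (s : ℝ → ℝ) (T : ℝ) : Set (ℝ × ℝ) :=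
  {p | p.1 = 0 ∧ 0 < p.2 ∧ p.2 ≤ T} ∪ {p | p.1 = s p.2 ∧ 0 < p.2 ∧ p.2 ≤ T} ∪
    {p | p.2 = 0 ∧ 0 ≤ p.1 ∧ p.1 ≤ s 0}

/-- The space derivative `u_x (x, t)` of a function on `[0, b₀] × [0, T]` (one-sided at `x = 0` and
`x = b₀`). -/
def spaceDeriv (b₀ : ℝ) (u : ℝ → ℝ → ℝ) (x t : ℝ) : ℝ :=
  derivWithin (fun y => u y t) (Icc 0 b₀) x

/-- `{u, s}` is a solution on `[0, T]` of the one-phase fractional Stefan problem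
* `u_t = ∂/∂x (ᴿᴸ₀D_t^{1-α} u_x)` for `0 < x < s(t)`, `0 < t < T`,
* `u(0, t) = 1` for `0 < t ≤ T`,
* `u(s(t), t) = 0` for `0 < t ≤ T`, and `s(0) = 0`,
* `s'(t) = - ᴿᴸ₀D_t^{1-α} u_x (x, t)` at `(s(t), t)`, for `0 < t ≤ T`. -/
structure IsFractionalStefanSolution (α T : ℝ) (u : ℝ → ℝ → ℝ) (s : ℝ → ℝ) : Prop where
  /-- The free boundary is continuous up to `t = 0` and `t = T`, so that `b₀` is a maximum. -/
  front_continuousOn : ContinuousOn s (Icc 0 T)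
  /-- `s ∈ C¹(0, T)`. -/
  front_contDiffOn : ContDiffOn ℝ 1 s (Ioo 0 T)
  /-- `u_x` exists on `[0, b₀] × (0, T]`. -/
  space_differentiable : ∀ x ∈ Icc 0 (frontMax s T), ∀ t ∈ Ioc 0 T,
    DifferentiableWithinAt ℝ (fun y => u y t) (Icc 0 (frontMax s T)) x
  /-- `u_x` is continuous in `Ω_T`. -/
  spaceDeriv_continuousOn :
    ContinuousOn (fun p : ℝ × ℝ => spaceDeriv (frontMax s T) u p.1 p.2) (stefanRegion s T)
  /-- `u_xx` exists in `Ω_T`. -/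
  spaceDeriv_differentiableAt : ∀ p ∈ stefanRegion s T,
    DifferentiableAt ℝ (fun y => spaceDeriv (frontMax s T) u y p.2) p.1
  /-- `u_xx` is continuous in `Ω_T`. -/
  spaceDeriv_deriv_continuousOn :
    ContinuousOn (fun p : ℝ × ℝ => deriv (fun y => spaceDeriv (frontMax s T) u y p.2) p.1)
      (stefanRegion s T)
  /-- `u_x(x, ·)` is absolutely continuous on `(0, T)` for `0 < x ≤ b₀`. -/
  spaceDeriv_ac : ∀ x ∈ Ioc 0 (frontMax s T),
    ACOpenInterval (spaceDeriv (frontMax s T) u x) 0 T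
  /-- On the fixed face `x = 0`, `u_x` is locally absolutely continuous on `(0, T)`. -/
  spaceDeriv_ac_face : ACLocOpenInterval (spaceDeriv (frontMax s T) u 0) 0 T
  /-- `u_x(x, ·) ∈ L¹(0, T)` for `0 ≤ x ≤ b₀`. -/
  spaceDeriv_integrable : ∀ x ∈ Icc 0 (frontMax s T),
    IntegrableOn (spaceDeriv (frontMax s T) u x) (Ioo 0 T)
  /-- `u` is continuous in `Ω_T` together with its parabolic boundary, except perhaps at the
  origin. -/
  temp_continuousOn : ContinuousOn (fun p : ℝ × ℝ => u p.1 p.2)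
    ((stefanRegion s T ∪ stefanParabolicBoundary s T) \ {(0, 0)})
  /-- `0 ≤ lim inf u` at the origin. -/
  temp_liminf : (0 : EReal) ≤ liminf (fun p : ℝ × ℝ => (u p.1 p.2 : EReal))
    (𝓝[(stefanRegion s T ∪ stefanParabolicBoundary s T) \ {(0, 0)}] (0, 0))
  /-- `lim sup u < ∞` at the origin. -/
  temp_limsup : limsup (fun p : ℝ × ℝ => (u p.1 p.2 : EReal))
    (𝓝[(stefanRegion s T ∪ stefanParabolicBoundary s T) \ {(0, 0)}] (0, 0)) < ⊤
  /-- The fractional derivative of `u_x` in time exists in `Ω_T`. -/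
  rl_exists : ∀ p ∈ stefanRegion s T,
    RLDifferentiableAt T (1 - α) (spaceDeriv (frontMax s T) u p.1) p.2
  /-- The fractional derivative of `u_x` in time exists on the free boundary. -/
  rl_exists_front : ∀ t ∈ Ioc 0 T,
    RLDifferentiableAt T (1 - α) (spaceDeriv (frontMax s T) u (s t)) t
  /-- The flux is differentiable in `x`. -/
  flux_differentiableAt : ∀ x t : ℝ, 0 < x → x < s t → 0 < t → t < T →
    DifferentiableAt ℝ (fun y => rlDeriv T (1 - α) (spaceDeriv (frontMax s T) u y) t) x
  /-- The fractional diffusion equation. -/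
  diffusion : ∀ x t : ℝ, 0 < x → x < s t → 0 < t → t < T →
    HasDerivAt (fun τ => u x τ)
      (deriv (fun y => rlDeriv T (1 - α) (spaceDeriv (frontMax s T) u y) t) x) t
  /-- The condition at the fixed face. -/
  fixed_face : ∀ t ∈ Ioc 0 T, u 0 t = 1
  /-- The temperature at the free boundary. -/
  free_boundary : ∀ t ∈ Ioc 0 T, u (s t) t = 0
  /-- The free boundary starts at the fixed face. -/
  front_zero : s 0 = 0
  /-- The fractional Stefan condition (with the left derivative of `s` at `t = T`). -/
  stefan_condition : ∀ t ∈ Ioc 0 T,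
    HasDerivWithinAt s (-rlDeriv T (1 - α) (spaceDeriv (frontMax s T) u (s t)) t) (Icc 0 T) t

/-- The similarity temperature. -/
def similarityTemp (α ξ x t : ℝ) : ℝ :=
  1 - 1 / (1 - wright (-2 * ξ) (-α / 2) 1) * (1 - wright (-(x / t ^ (α / 2))) (-α / 2) 1)

/-- The similarity free boundary. -/
def similarityFront (α ξ t : ℝ) : ℝ := 2 * ξ * t ^ (α / 2)

/-- `ξ` is a positive solution of the similarity equation. -/
def IsSimilarityRoot (α ξ : ℝ) : Prop :=
  0 < ξ ∧
    2 * ξ * (1 - wright (-2 * ξ) (-α / 2) 1) =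
      2 * ξ * wright (-2 * ξ) (-α / 2) 1 + wright (-2 * ξ) (-α / 2) (1 + α / 2)

end

/-! Put ν = α/2 and K_β(x,t) = t^(β-1) W(-x/t^ν, -ν, β). Differentiation in x sends K_β to -K_(β-ν),
and differentiation in t sends it to K_(β-1). With A = 1/(1 - W(-2ξ, -ν, 1)) the candidate is u = 1
- A(1 - K_1), so u_x = -A K_(1-ν). The Riemann–Liouville derivative of order 1-α = 1-2ν raises this
parameter by 2ν-1, so the flux is -A K_ν. Its x-derivative and u_t are then both A K_0, which is the
diffusion equation. On the front the similarity variable x/t^ν is the constant 2ξ, so the Stefan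
condition becomes a scalar equation in ξ. The recurrence `wright_sub_one` identifies it with the
stated one.

The action of fractional integration on K_β is read off from the Laplace transform σ^(-β) exp(-x
σ^ν) of K_β in t, for 0 < β < 1 (`laplace_wrightKernel`), together with uniqueness of transforms on
the positive integers (`eqOn_of_laplace_eq`, `rlIntegral_wrightKernel`). To find the transform, the
reflection formula writes K_β as a Laplace integral of an explicit density `cutDensity`. The
transform of K_β is then a Stieltjes integral, which Cauchy's theorem evaluates on a rectangle in
the logarithmic variable.

Existence and uniqueness of ξ, and 0 ≤ u ≤ 1, rest on W(-z, -ν, 1-ν) ≥ 0 for z > 0. The transform of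
K_β at the points k+1 is a product of two completely monotone sequences, and Bernstein polynomials
turn this into K_β ≥ 0 (`wrightKernel_nonneg`). Hence W(-z, -ν, 1) and W(-z, -ν, ν) decrease in z ≥
0. In the form 2ξ(1 - W(-2ξ, -ν, 1)) = W(-2ξ, -ν, ν)/ν the left side strictly increases and the
right side does not, so there is exactly one root. -/

/-! ### Reciprocal Gamma function and exponential generating series -/

/-- Euler's reflection formula, solved for 1/Γ(w). At the poles the sine vanishes and `Real.Gamma`
is 0, so the identity persists there. -/
theorem one_div_Gamma_eq (w : ℝ) (hw : w < 1) :
    1 / Real.Gamma w = Real.Gamma (1 - w) * Real.sin (Real.pi * w) / Real.pi := by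
  have h := Real.Gamma_mul_Gamma_one_sub w
  have h1 : 0 < Real.Gamma (1 - w) := Real.Gamma_pos_of_pos (by linarith)
  have hpi := Real.pi_pos
  by_cases hs : Real.sin (Real.pi * w) = 0
  · rw [hs, div_zero] at h
    have : Real.Gamma w = 0 := by
      rcases mul_eq_zero.1 h with h | h
      · exact h
      · exact absurd h h1.ne'
    simp [this, hs]
  · have hG : Real.Gamma w ≠ 0 := by
      intro h0
      rw [h0, zero_mul, eq_comm, div_eq_zero_iff] at h
      rcases h with h | h
      · exact hpi.ne' h
      · exact hs h
    rw [eq_div_iff hs] at h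
    rw [div_eq_div_iff hG hpi.ne']
    linarith

/-- The functional equation of Γ. At w = 1 it survives because `Real.Gamma 0 = 0`. -/
theorem one_div_Gamma_sub_one (w : ℝ) :
    1 / Real.Gamma (w - 1) = (w - 1) * (1 / Real.Gamma w) := by
  by_cases hw : w = 1
  · subst hw; simp [Real.Gamma_zero]
  · have h := Real.Gamma_add_one (sub_ne_zero.2 hw)
    rw [sub_add_cancel] at h
    rw [h]
    have : w - 1 ≠ 0 := sub_ne_zero.2 hw
    field_simp

/-- Exponential generating series with everywhere convergent coefficients may be differentiated
by shifting the coefficients. -/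
theorem hasDerivAt_tsum_pow_div_factorial {a : ℕ → ℝ}
    (ha : ∀ R : ℝ, Summable fun k : ℕ => R ^ k / (k.factorial : ℝ) * |a k|)
    (ha' : ∀ R : ℝ, Summable fun k : ℕ => R ^ k / (k.factorial : ℝ) * |a (k + 1)|) (z : ℝ) :
    HasDerivAt (fun z : ℝ => ∑' k : ℕ, z ^ k / (k.factorial : ℝ) * a k)
      (∑' k : ℕ, z ^ k / (k.factorial : ℝ) * a (k + 1)) z := by
  have hsum : Summable fun k : ℕ => z ^ k / (k.factorial : ℝ) * a (k + 1) := by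
    refine Summable.of_norm_bounded (ha' |z|) fun k => ?_
    rw [norm_mul, norm_div, norm_pow, Real.norm_eq_abs, Real.norm_eq_abs, Real.norm_eq_abs,
      Nat.abs_cast]
  have hsucc : ∀ (y : ℝ) (k : ℕ), ((k + 1 : ℕ) : ℝ) * y ^ k / ((k + 1).factorial : ℝ) * a (k + 1) =
      y ^ k / (k.factorial : ℝ) * a (k + 1) := by
    intro y k
    rw [Nat.factorial_succ]
    push_cast
    have : (k.factorial : ℝ) ≠ 0 := by positivity
    have : (k : ℝ) + 1 ≠ 0 := by positivity
    field_simp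
  have key := hasDerivAt_tsum_of_isPreconnected
    (u := fun k : ℕ => (k : ℝ) * (|z| + 1) ^ (k - 1) / (k.factorial : ℝ) * |a k|)
    (g := fun (k : ℕ) (z : ℝ) => z ^ k / (k.factorial : ℝ) * a k)
    (g' := fun (k : ℕ) (z : ℝ) => (k : ℝ) * z ^ (k - 1) / (k.factorial : ℝ) * a k)
    (t := Metric.ball 0 (|z| + 1)) (y₀ := 0) (y := z) ?_ Metric.isOpen_ball
    (convex_ball _ _).isPreconnected ?_ ?_ ?_ ?_ ?_
  · refine key.congr_deriv ?_
    rw [Summable.tsum_eq_zero_add]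
    · simp only [Nat.cast_zero, zero_mul, zero_div, zero_add, Nat.add_sub_cancel]
      exact tsum_congr fun k => hsucc z k
    · rw [← summable_nat_add_iff 1]
      simpa only [Nat.add_sub_cancel, hsucc] using hsum
  · rw [← summable_nat_add_iff 1]
    refine (ha' (|z| + 1)).congr fun k => ?_
    rw [Nat.factorial_succ]
    push_cast
    have : (k.factorial : ℝ) ≠ 0 := by positivity
    have : (k : ℝ) + 1 ≠ 0 := by positivity
    field_simp
  · intro k y _
    exact ((hasDerivAt_pow k y).div_const _).mul_const _
  · intro k y hy
    rw [mem_ball_zero_iff, Real.norm_eq_abs] at hy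
    rw [norm_mul, norm_div, norm_mul, norm_pow, Real.norm_eq_abs, Real.norm_eq_abs,
      Real.norm_eq_abs, Real.norm_eq_abs, Nat.abs_cast, Nat.abs_cast]
    gcongr
  · simp; positivity
  · refine Summable.of_norm_bounded (ha 0) fun k => ?_
    rw [norm_mul, norm_div, norm_pow, Real.norm_eq_abs, Real.norm_eq_abs, Real.norm_eq_abs,
      Nat.abs_cast, abs_zero]
  · simp

/-! ### Absolute convergence of the Wright series -/

section Majorant

variable {ν : ℝ}

theorem exists_mul_rpow_le (hν0 : 0 < ν) (hν1 : ν < 1) (R : ℝ) :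
    ∃ C : ℝ, ∀ r : ℝ, 0 < r → R * r ^ ν ≤ r / 2 + C := by
  -- Chosen so that r₀^(1-ν) = 2(|R|+1). Beyond r₀ this gives |R| r^ν ≤ r/2; below r₀ the constant
  -- |R| r₀^ν suffices.
  set r₀ : ℝ := (2 * (|R| + 1)) ^ (1 / (1 - ν)) with hr₀
  have hr₀pos : 0 < r₀ := by positivity
  refine ⟨|R| * r₀ ^ ν, fun r hr => ?_⟩
  have hR : R * r ^ ν ≤ |R| * r ^ ν := by gcongr; exact le_abs_self R
  refine hR.trans ?_
  rcases le_total r r₀ with h | h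
  · have : r ^ ν ≤ r₀ ^ ν := Real.rpow_le_rpow hr.le h hν0.le
    have : |R| * r ^ ν ≤ |R| * r₀ ^ ν := by gcongr
    linarith
  · have h1 : 2 * (|R| + 1) ≤ r ^ (1 - ν) := by
      calc 2 * (|R| + 1) = r₀ ^ (1 - ν) := by
            rw [hr₀, ← Real.rpow_mul (by positivity), one_div_mul_cancel (by linarith),
              Real.rpow_one]
        _ ≤ r ^ (1 - ν) := Real.rpow_le_rpow hr₀pos.le h (by linarith)
    have h2 : r ^ (1 - ν) * r ^ ν = r := by
      rw [← Real.rpow_add hr]; simp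
    have h3 : 0 < r ^ ν := by positivity
    have h4 : 0 ≤ |R| * r₀ ^ ν := by positivity
    nlinarith [mul_le_mul_of_nonneg_right h1 h3.le]

theorem integrableOn_exp_rpow_majorant (hν0 : 0 < ν) (hν1 : ν < 1) {β : ℝ} (hβ : β < 1) (R : ℝ) :
    IntegrableOn (fun r : ℝ => Real.exp (-r) * r ^ (-β) * Real.exp (R * r ^ ν)) (Ioi 0) := by
  obtain ⟨C, hC⟩ := exists_mul_rpow_le hν0 hν1 R
  have h := (integrableOn_rpow_mul_exp_neg_mul_rpow (p := 1) (s := -β) (b := 1 / 2)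
    (by linarith) one_pos (by norm_num)).mul_const (Real.exp C)
  refine Integrable.mono' h ?_ ?_
  · refine Measurable.aestronglyMeasurable ?_
    fun_prop
  · refine (ae_restrict_iff' measurableSet_Ioi).2 (Eventually.of_forall fun r (hr : 0 < r) => ?_)
    rw [Real.norm_of_nonneg (by positivity), mul_comm (Real.exp (-r)), mul_assoc, mul_assoc,
      ← Real.exp_add, ← Real.exp_add]
    refine mul_le_mul_of_nonneg_left (Real.exp_le_exp.2 ?_) (by positivity)
    rw [Real.rpow_one]
    have := hC r hr
    linarith

theorem integral_exp_neg_mul_rpow_mul_pow (hν0 : 0 < ν) {β : ℝ} (hβ : β < 1) (k : ℕ) :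
    IntegrableOn (fun r : ℝ => Real.exp (-r) * r ^ (-β) * (r ^ ν) ^ k) (Ioi 0) ∧
    ∫ r in Ioi (0 : ℝ), Real.exp (-r) * r ^ (-β) * (r ^ ν) ^ k = Real.Gamma (1 - (β - ν * k)) := by
  have hpos : 0 < 1 - (β - ν * k) := by
    have : 0 ≤ ν * k := by positivity
    linarith
  have hcongr : EqOn (fun r : ℝ => Real.exp (-r) * r ^ (1 - (β - ν * k) - 1))
      (fun r : ℝ => Real.exp (-r) * r ^ (-β) * (r ^ ν) ^ k) (Ioi 0) := by
    intro r (hr : 0 < r)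
    simp only
    rw [← Real.rpow_natCast, ← Real.rpow_mul hr.le, mul_assoc, ← Real.rpow_add hr]
    congr 2; ring
  refine ⟨(integrableOn_congr_fun hcongr measurableSet_Ioi).1
    (Real.GammaIntegral_convergent hpos), ?_⟩
  rw [Real.Gamma_eq_integral hpos]
  exact (setIntegral_congr_fun measurableSet_Ioi hcongr).symm

/-- Each Gamma value is an Euler integral. Under the integral sign the partial sums are those of
exp(R r^ν), so they are bounded by the integral of an integrable majorant. -/
theorem summable_pow_mul_Gamma (hν0 : 0 < ν) (hν1 : ν < 1) {β : ℝ} (hβ : β < 1) {R : ℝ}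
    (hR : 0 ≤ R) :
    Summable fun k : ℕ => R ^ k / (k.factorial : ℝ) * Real.Gamma (1 - (β - ν * k)) := by
  have hG : ∀ k : ℕ, 0 < Real.Gamma (1 - (β - ν * k)) := fun k => by
    have : 0 ≤ ν * k := by positivity
    exact Real.Gamma_pos_of_pos (by linarith)
  refine summable_of_sum_range_le (c := ∫ r in Ioi (0 : ℝ),
    Real.exp (-r) * r ^ (-β) * Real.exp (R * r ^ ν)) (fun k => by have := hG k; positivity) ?_
  intro n
  simp_rw [← fun k : ℕ => (integral_exp_neg_mul_rpow_mul_pow hν0 hβ k).2, ← integral_const_mul]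
  rw [← integral_finsetSum _ fun k _ => ((integral_exp_neg_mul_rpow_mul_pow hν0 hβ k).1.const_mul _)]
  refine setIntegral_mono_on (integrable_finsetSum _ fun k _ =>
    ((integral_exp_neg_mul_rpow_mul_pow hν0 hβ k).1.const_mul _))
    (integrableOn_exp_rpow_majorant hν0 hν1 hβ R) measurableSet_Ioi fun r (hr : 0 < r) => ?_
  have h := Real.sum_le_exp_of_nonneg (x := R * r ^ ν) (by positivity) n
  calc ∑ k ∈ Finset.range n, R ^ k / (k.factorial : ℝ) * (Real.exp (-r) * r ^ (-β) * (r ^ ν) ^ k)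
      = Real.exp (-r) * r ^ (-β) * ∑ k ∈ Finset.range n, (R * r ^ ν) ^ k / (k.factorial : ℝ) := by
        rw [Finset.mul_sum]
        refine Finset.sum_congr rfl fun k _ => ?_
        rw [mul_pow]; ring
    _ ≤ _ := mul_le_mul_of_nonneg_left h (by positivity)

/-- For β < 1 the reflection formula bounds |1/Γ(β - νk)| by Γ(1 - β + νk). Larger β are reached by
induction: dropping the first term of the series replaces β by β - ν. -/
theorem summable_wright_abs_of_lt (hν0 : 0 < ν) (hν1 : ν < 1) (n : ℕ) :
    ∀ β : ℝ, β < 1 + n * ν → ∀ R : ℝ, 0 ≤ R →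
      Summable fun k : ℕ => R ^ k / (k.factorial : ℝ) * |1 / Real.Gamma (β - ν * k)| := by
  induction n with
  | zero =>
    intro β hβ R hR
    have hβ' : β < 1 := by simpa using hβ
    refine Summable.of_nonneg_of_le (fun k => by positivity) (fun k => ?_)
      (summable_pow_mul_Gamma hν0 hν1 hβ' hR)
    have h0 : 0 ≤ ν * k := by positivity
    have hG := Real.Gamma_pos_of_pos (s := 1 - (β - ν * k)) (by linarith)
    refine mul_le_mul_of_nonneg_left ?_ (by positivity)
    rw [one_div_Gamma_eq _ (by linarith), abs_div, abs_mul, abs_of_pos hG, abs_of_pos Real.pi_pos,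
      div_le_iff₀ Real.pi_pos]
    have h1 := Real.abs_sin_le_one (Real.pi * (β - ν * k))
    have h2 := Real.pi_gt_three
    nlinarith
  | succ n ih =>
    intro β hβ R hR
    rw [← summable_nat_add_iff 1]
    refine Summable.of_nonneg_of_le (fun k => by positivity) (fun k => ?_)
      ((ih (β - ν) (by push_cast at hβ; linarith) R hR).mul_left R)
    rw [show β - ν * ((k + 1 : ℕ) : ℝ) = β - ν - ν * k by push_cast; ring, ← mul_assoc, pow_succ']
    refine mul_le_mul_of_nonneg_right ?_ (abs_nonneg _)
    rw [mul_div_assoc]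
    refine mul_le_mul_of_nonneg_left ?_ hR
    gcongr
    omega

theorem summable_wright_abs (hν0 : 0 < ν) (hν1 : ν < 1) (β R : ℝ) :
    Summable fun k : ℕ => R ^ k / (k.factorial : ℝ) * |1 / Real.Gamma (β - ν * k)| := by
  obtain ⟨n, hn⟩ := exists_nat_gt ((β - 1) / ν)
  rw [div_lt_iff₀ hν0] at hn
  refine Summable.of_norm_bounded (summable_wright_abs_of_lt hν0 hν1 n β (by linarith) |R| (abs_nonneg R))
    fun k => ?_
  simp

theorem summable_wright (hν0 : 0 < ν) (hν1 : ν < 1) (β z : ℝ) :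
    Summable fun k : ℕ => z ^ k / (k.factorial : ℝ) * (1 / Real.Gamma (β - ν * k)) := by
  refine Summable.of_norm_bounded (summable_wright_abs hν0 hν1 β |z|) fun k => ?_
  simp

end Majorant

/-! ### Derivative and recurrence of the Wright function -/

theorem wright_neg_eq (z ν β : ℝ) :
    wright z (-ν) β = ∑' k : ℕ, z ^ k / (k.factorial : ℝ) * (1 / Real.Gamma (β - ν * k)) := by
  unfold wright
  refine tsum_congr fun k => ?_
  rw [show -ν * (k : ℝ) + β = β - ν * k by ring, div_mul_div_comm, mul_one]

theorem wright_zero (ν β : ℝ) : wright 0 (-ν) β = 1 / Real.Gamma β := by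
  rw [wright_neg_eq, tsum_eq_single 0]
  · simp
  · intro k hk; simp [hk]

section Derivatives

variable {ν : ℝ}

theorem hasDerivAt_wright (hν0 : 0 < ν) (hν1 : ν < 1) (β z : ℝ) :
    HasDerivAt (fun z => wright z (-ν) β) (wright z (-ν) (β - ν)) z := by
  have hs : ∀ k : ℕ, β - ν * ((k + 1 : ℕ) : ℝ) = β - ν - ν * k := fun k => by push_cast; ring
  have h := hasDerivAt_tsum_pow_div_factorial (a := fun k : ℕ => 1 / Real.Gamma (β - ν * k))
    (summable_wright_abs hν0 hν1 β)
    (by simpa only [hs] using summable_wright_abs hν0 hν1 (β - ν)) z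
  simp only [hs] at h
  simpa only [wright_neg_eq] using h

theorem continuous_wright (hν0 : 0 < ν) (hν1 : ν < 1) (β : ℝ) :
    Continuous fun z => wright z (-ν) β :=
  continuous_iff_continuousAt.2 fun z => (hasDerivAt_wright hν0 hν1 β z).continuousAt

/-- By the functional equation of Γ the k-th coefficient acquires the factor β - 1 - νk. The part
with k cancels against k! and shifts the index, which turns β into β - ν. -/
theorem wright_sub_one (hν0 : 0 < ν) (hν1 : ν < 1) (β z : ℝ) :
    wright z (-ν) (β - 1) = (β - 1) * wright z (-ν) β - ν * z * wright z (-ν) (β - ν) := by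
  have h1 := summable_wright hν0 hν1 β z
  have h2 := summable_wright hν0 hν1 (β - ν) z
  have h3 : HasSum (fun k : ℕ => ν * (k : ℝ) * (z ^ k / (k.factorial : ℝ) *
      (1 / Real.Gamma (β - ν * k)))) (ν * z * wright z (-ν) (β - ν)) := by
    rw [wright_neg_eq, ← hasSum_nat_add_iff' 1]
    simp only [Finset.range_one, Finset.sum_singleton, Nat.cast_zero, mul_zero, zero_mul, sub_zero]
    refine (h2.hasSum.mul_left (ν * z)).congr_fun ?_
    intro k
    rw [show β - ν * ((k + 1 : ℕ) : ℝ) = β - ν - ν * k by push_cast; ring, Nat.factorial_succ,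
      pow_succ']
    push_cast
    have : (k.factorial : ℝ) ≠ 0 := by positivity
    have : (k : ℝ) + 1 ≠ 0 := by positivity
    generalize (1 / Real.Gamma (β - ν - ν * k)) = G
    field_simp
  have h4 := (h1.hasSum.mul_left (β - 1)).sub h3
  rw [← wright_neg_eq] at h4
  rw [← h4.tsum_eq, wright_neg_eq]
  refine tsum_congr fun k => ?_
  rw [show β - 1 - ν * k = (β - ν * k) - 1 by ring, one_div_Gamma_sub_one]
  ring

end Derivatives

/-! ### Self-similar kernels -/

/-- The self-similar function `t ^ (β - 1) W(-x t ^ (-ν), -ν, β)`. -/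
noncomputable def wrightKernel (ν β x t : ℝ) : ℝ := t ^ (β - 1) * wright (-(x / t ^ ν)) (-ν) β

section Kernel

variable {ν : ℝ}

theorem hasDerivAt_wrightKernel_space (hν0 : 0 < ν) (hν1 : ν < 1) (β x : ℝ) {t : ℝ} (ht : 0 < t) :
    HasDerivAt (fun x => wrightKernel ν β x t) (-wrightKernel ν (β - ν) x t) x := by
  have h1 : HasDerivAt (fun x : ℝ => -(x / t ^ ν)) (-(1 / t ^ ν)) x :=
    ((hasDerivAt_id x).div_const _).neg
  have h := ((hasDerivAt_wright hν0 hν1 β (-(x / t ^ ν))).comp x h1).const_mul (t ^ (β - 1))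
  refine h.congr_deriv ?_
  unfold wrightKernel
  rw [show β - ν - 1 = (β - 1) - ν by ring, Real.rpow_sub ht (β - 1) ν]
  ring

/-- The product rule gives one term from the power of t and one from the argument of W. Their sum is
the right side of `wright_sub_one`. -/
theorem hasDerivAt_wrightKernel_time (hν0 : 0 < ν) (hν1 : ν < 1) (β x : ℝ) {t : ℝ} (ht : 0 < t) :
    HasDerivAt (fun t => wrightKernel ν β x t) (wrightKernel ν (β - 1) x t) t := by
  have h0 : HasDerivAt (fun t : ℝ => x * t ^ (-ν)) (x * (-ν * t ^ (-ν - 1))) t :=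
    (Real.hasDerivAt_rpow_const (Or.inl ht.ne')).const_mul x
  have h1 : HasDerivAt (fun t : ℝ => -(x / t ^ ν)) (-(x * (-ν * t ^ (-ν - 1)))) t := by
    refine h0.neg.congr_of_eventuallyEq ?_
    filter_upwards [lt_mem_nhds ht] with s hs
    simp [Real.rpow_neg hs.le, div_eq_mul_inv]
  have h2 : HasDerivAt (fun t : ℝ => t ^ (β - 1)) ((β - 1) * t ^ (β - 1 - 1)) t :=
    Real.hasDerivAt_rpow_const (Or.inl ht.ne')
  have h := h2.mul ((hasDerivAt_wright hν0 hν1 β (-(x / t ^ ν))).comp t h1)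
  refine h.congr_deriv ?_
  unfold wrightKernel
  simp only [Function.comp_apply]
  rw [wright_sub_one hν0 hν1 β, Real.rpow_sub ht (β - 1) 1, Real.rpow_sub ht (-ν) 1,
    Real.rpow_neg ht.le, Real.rpow_one]
  have : t ^ ν ≠ 0 := by positivity
  field_simp
  ring

theorem continuousOn_wrightKernel (hν0 : 0 < ν) (hν1 : ν < 1) (β : ℝ) :
    ContinuousOn (fun p : ℝ × ℝ => wrightKernel ν β p.1 p.2) {p | 0 < p.2} := by
  unfold wrightKernel
  have h : ∀ γ : ℝ, ContinuousOn (fun p : ℝ × ℝ => p.2 ^ γ) {p : ℝ × ℝ | 0 < p.2} := fun γ p hp =>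
    (continuousAt_snd.rpow_const (Or.inl (ne_of_gt hp))).continuousWithinAt
  refine (h _).mul ((continuous_wright hν0 hν1 β).comp_continuousOn ?_)
  exact (continuousOn_fst.div (h ν) fun p (hp : 0 < p.2) => by positivity).neg

theorem continuousOn_wrightKernel_time (hν0 : 0 < ν) (hν1 : ν < 1) (β x : ℝ) :
    ContinuousOn (wrightKernel ν β x) (Ioi 0) := fun t (ht : 0 < t) =>
  (hasDerivAt_wrightKernel_time hν0 hν1 β x ht).continuousAt.continuousWithinAt

end Kernel

/-! ### The kernel as a Laplace integral -/

/-- The density of the representation of `wrightKernel ν β x` as a Laplace transform. -/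
noncomputable def cutDensity (ν β x r : ℝ) : ℝ :=
  r ^ (-β) * Real.exp (-(x * r ^ ν * Real.cos (Real.pi * ν))) *
    Real.sin (Real.pi * β + x * r ^ ν * Real.sin (Real.pi * ν))

/-- Imaginary part of the expansion of e^(ib) exp(-y e^(-ia)). -/
theorem hasSum_exp_mul_sin (a b y : ℝ) :
    HasSum (fun k : ℕ => (-y) ^ k / (k.factorial : ℝ) * Real.sin (b - a * k))
      (Real.exp (-(y * Real.cos a)) * Real.sin (b + y * Real.sin a)) := by
  have h := NormedSpace.expSeries_div_hasSum_exp (𝔸 := ℂ)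
    (-(y : ℂ) * Complex.exp (-(a : ℂ) * Complex.I))
  rw [← Complex.exp_eq_exp_ℂ] at h
  have h2 := Complex.hasSum_im (h.mul_left (Complex.exp ((b : ℂ) * Complex.I)))
  convert h2 using 1
  · funext k
    rw [mul_pow, ← Complex.exp_nat_mul, mul_div_right_comm, mul_left_comm, ← Complex.exp_add,
      show (b : ℂ) * Complex.I + (k : ℂ) * (-(a : ℂ) * Complex.I) =
        ((b - a * k : ℝ) : ℂ) * Complex.I by push_cast; ring,
      show (-(y : ℂ)) ^ k / (k.factorial : ℂ) = (((-y) ^ k / (k.factorial : ℝ) : ℝ) : ℂ) by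
        push_cast; ring, Complex.im_ofReal_mul, Complex.exp_ofReal_mul_I_im]
  · rw [show -(a : ℂ) * Complex.I = ((-a : ℝ) : ℂ) * Complex.I by push_cast; ring,
      ← Complex.exp_add, Complex.exp_im]
    simp [Complex.exp_re, Complex.exp_im]

/-- Reflection writes each 1/Γ(β - νk) as a sine times an Euler integral. Sum and integral may be
interchanged by `summable_pow_mul_Gamma`, and the inner sum is `hasSum_exp_mul_sin`. -/
theorem wright_neg_eq_integral {ν β : ℝ} (hν0 : 0 < ν) (hν1 : ν < 1) (hβ : β < 1) (z : ℝ) :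
    wright (-z) (-ν) β =
      1 / Real.pi * ∫ r in Ioi (0 : ℝ), Real.exp (-r) * cutDensity ν β z r := by
  set F : ℕ → ℝ → ℝ := fun k r => (-z) ^ k / (k.factorial : ℝ) *
    Real.sin (Real.pi * β - Real.pi * ν * k) * (Real.exp (-r) * r ^ (-β) * (r ^ ν) ^ k) with hF
  have hint : ∀ k, IntegrableOn (F k) (Ioi 0) := fun k =>
    (integral_exp_neg_mul_rpow_mul_pow hν0 hβ k).1.const_mul _
  have hval : ∀ k, ∫ r in Ioi (0 : ℝ), F k r =
      Real.pi * ((-z) ^ k / (k.factorial : ℝ) * (1 / Real.Gamma (β - ν * k))) := fun k => by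
    have : 0 ≤ ν * k := by positivity
    rw [hF, integral_const_mul, (integral_exp_neg_mul_rpow_mul_pow hν0 hβ k).2,
      one_div_Gamma_eq _ (by linarith), show Real.pi * β - Real.pi * ν * k =
        Real.pi * (β - ν * k) by ring]
    have := Real.pi_ne_zero
    field_simp
  have hnorm : Summable fun k => ∫ r in Ioi (0 : ℝ), ‖F k r‖ := by
    refine Summable.of_nonneg_of_le (fun k => integral_nonneg fun r => norm_nonneg _) (fun k => ?_)
      (summable_pow_mul_Gamma hν0 hν1 hβ (abs_nonneg z))
    rw [← (integral_exp_neg_mul_rpow_mul_pow hν0 hβ k).2, ← integral_const_mul]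
    refine setIntegral_mono_on (hint k).norm ((integral_exp_neg_mul_rpow_mul_pow hν0 hβ k).1.const_mul _)
      measurableSet_Ioi fun r (hr : 0 < r) => ?_
    rw [hF, norm_mul, norm_mul, norm_div, norm_pow, norm_neg, Real.norm_eq_abs, Real.norm_eq_abs,
      Real.norm_eq_abs, Real.norm_of_nonneg (by positivity :
        0 ≤ Real.exp (-r) * r ^ (-β) * (r ^ ν) ^ k), Nat.abs_cast]
    refine mul_le_mul_of_nonneg_right ?_ (by positivity)
    exact mul_le_of_le_one_right (by positivity) (Real.abs_sin_le_one _)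
  have h := hasSum_integral_of_summable_integral_norm hint hnorm
  simp_rw [hval] at h
  have h1 := (summable_wright hν0 hν1 β (-z)).hasSum.mul_left Real.pi
  rw [← wright_neg_eq] at h1
  have h2 := h1.unique h
  rw [setIntegral_congr_fun (g := fun r => Real.exp (-r) * cutDensity ν β z r) measurableSet_Ioi]
    at h2
  · rw [← h2]
    have := Real.pi_ne_zero
    field_simp
  · intro r _
    have h3 := (hasSum_exp_mul_sin (Real.pi * ν) (Real.pi * β) (z * r ^ ν)).mul_left
      (Real.exp (-r) * r ^ (-β))
    simp only [cutDensity]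
    rw [show Real.exp (-r) * (r ^ (-β) * Real.exp (-(z * r ^ ν * Real.cos (Real.pi * ν))) *
      Real.sin (Real.pi * β + z * r ^ ν * Real.sin (Real.pi * ν))) = Real.exp (-r) * r ^ (-β) *
      (Real.exp (-(z * r ^ ν * Real.cos (Real.pi * ν))) *
      Real.sin (Real.pi * β + z * r ^ ν * Real.sin (Real.pi * ν))) by ring, ← h3.tsum_eq]
    refine tsum_congr fun k => ?_
    simp only [hF]
    rw [show -(z * r ^ ν) = (-z) * r ^ ν by ring, mul_pow]
    ring

theorem cutDensity_mul {ν β x t r : ℝ} (ht : 0 < t) (hr : 0 < r) :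
    cutDensity ν β x (t * r) = t ^ (-β) * cutDensity ν β (x * t ^ ν) r := by
  unfold cutDensity
  rw [Real.mul_rpow ht.le hr.le, Real.mul_rpow ht.le hr.le, ← mul_assoc x]
  ring

theorem wrightKernel_eq_integral {ν β : ℝ} (hν0 : 0 < ν) (hν1 : ν < 1) (hβ : β < 1) (x : ℝ) {t : ℝ}
    (ht : 0 < t) :
    wrightKernel ν β x t =
      1 / Real.pi * ∫ r in Ioi (0 : ℝ), Real.exp (-(t * r)) * cutDensity ν β x r := by
  unfold wrightKernel
  have h := integral_comp_mul_left_Ioi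
    (fun r => Real.exp (-r) * cutDensity ν β (x / t ^ ν) r) 0 ht
  rw [mul_zero, smul_eq_mul, inv_mul_eq_div, eq_div_iff ht.ne'] at h
  rw [wright_neg_eq_integral hν0 hν1 hβ, ← h, setIntegral_congr_fun
    (g := fun r => t ^ (-β) * (Real.exp (-(t * r)) * cutDensity ν β x r)) measurableSet_Ioi,
    integral_const_mul]
  · have h1 : t ^ (β - 1) * t * t ^ (-β) = 1 := by
      rw [Real.rpow_sub_one ht.ne', div_mul_cancel₀ _ ht.ne', ← Real.rpow_add ht]
      simp
    calc _ = (t ^ (β - 1) * t * t ^ (-β)) *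
          (1 / Real.pi * ∫ r in Ioi (0 : ℝ), Real.exp (-(t * r)) * cutDensity ν β x r) := by ring
      _ = _ := by rw [h1, one_mul]
  · intro r hr
    simp only
    rw [cutDensity_mul ht hr, div_mul_cancel₀ _ (by positivity)]
    ring

theorem cos_pi_mul_pos {ν : ℝ} (hν0 : 0 < ν) (hν1 : ν < 1 / 2) : 0 < Real.cos (Real.pi * ν) := by
  have := Real.pi_pos
  exact Real.cos_pos_of_mem_Ioo ⟨by nlinarith, by nlinarith⟩

theorem abs_cutDensity_le {ν β x r : ℝ} (hr : 0 < r) :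
    |cutDensity ν β x r| ≤ r ^ (-β) * Real.exp (-(x * Real.cos (Real.pi * ν)) * r ^ ν) := by
  unfold cutDensity
  rw [abs_mul, abs_of_nonneg (by positivity), show x * r ^ ν * Real.cos (Real.pi * ν) =
    x * Real.cos (Real.pi * ν) * r ^ ν by ring, ← neg_mul]
  exact mul_le_of_le_one_right (by positivity) (Real.abs_sin_le_one _)

theorem measurable_cutDensity (ν β x : ℝ) : Measurable (cutDensity ν β x) := by
  unfold cutDensity
  fun_prop

/-- Since ν < 1/2, cos(πν) > 0 and the density decays like exp(-x cos(πν) r^ν). This is where x > 0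
is needed. -/
theorem integrableOn_cutDensity {ν β x : ℝ} (hν0 : 0 < ν) (hν1 : ν < 1 / 2) (hβ : β < 1)
    (hx : 0 < x) : IntegrableOn (cutDensity ν β x) (Ioi 0) := by
  refine Integrable.mono' (integrableOn_rpow_mul_exp_neg_mul_rpow (p := ν) (s := -β)
    (b := x * Real.cos (Real.pi * ν)) (by linarith) hν0
    (mul_pos hx (cos_pi_mul_pos hν0 hν1))) (measurable_cutDensity ν β x).aestronglyMeasurable ?_
  exact (ae_restrict_iff' measurableSet_Ioi).2 (Eventually.of_forall fun r hr =>
    abs_cutDensity_le hr)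

theorem exists_abs_wrightKernel_le {ν β x : ℝ} (hν0 : 0 < ν) (hν1 : ν < 1 / 2) (hβ : β < 1)
    (hx : 0 < x) : ∃ C : ℝ, ∀ t : ℝ, 0 < t → |wrightKernel ν β x t| ≤ C := by
  refine ⟨1 / Real.pi * ∫ r in Ioi (0 : ℝ), |cutDensity ν β x r|, fun t ht => ?_⟩
  rw [wrightKernel_eq_integral hν0 (by linarith) hβ x ht, abs_mul,
    abs_of_pos (by have := Real.pi_pos; positivity : 0 < 1 / Real.pi)]
  refine mul_le_mul_of_nonneg_left ?_ (by have := Real.pi_pos; positivity)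
  rw [← Real.norm_eq_abs]
  refine norm_integral_le_of_norm_le (integrableOn_cutDensity hν0 hν1 hβ hx).abs ?_
  refine (ae_restrict_iff' measurableSet_Ioi).2 (Eventually.of_forall fun r (hr : 0 < r) => ?_)
  rw [norm_mul, Real.norm_of_nonneg (Real.exp_pos _).le]
  exact mul_le_of_le_one_left (abs_nonneg _) (Real.exp_le_one_iff.2 (by nlinarith))

theorem integrableOn_exp_mul_wrightKernel {ν β x : ℝ} (hν0 : 0 < ν) (hν1 : ν < 1 / 2) (hβ : β < 1)
    (hx : 0 < x) {σ : ℝ} (hσ : 0 < σ) :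
    IntegrableOn (fun t => Real.exp (-(σ * t)) * wrightKernel ν β x t) (Ioi 0) := by
  obtain ⟨C, hC⟩ := exists_abs_wrightKernel_le hν0 hν1 hβ hx
  have h : IntegrableOn (fun t => Real.exp (-σ * t) * C) (Ioi 0) :=
    (integrableOn_exp_mul_Ioi (by linarith) 0).mul_const C
  refine Integrable.mono' h ?_ ?_
  · refine ContinuousOn.aestronglyMeasurable ?_ measurableSet_Ioi
    exact (by fun_prop : Continuous fun t : ℝ => Real.exp (-(σ * t))).continuousOn.mul
      (continuousOn_wrightKernel_time hν0 (by linarith) β x)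
  · refine (ae_restrict_iff' measurableSet_Ioi).2 (Eventually.of_forall fun r (hr : 0 < r) => ?_)
    rw [norm_mul, Real.norm_of_nonneg (Real.exp_pos _).le, neg_mul]
    exact mul_le_mul_of_nonneg_left (hC r hr) (Real.exp_pos _).le

theorem integrableOn_rpow_div_add {β σ : ℝ} (hβ0 : 0 < β) (hβ1 : β < 1) (hσ : 0 < σ) :
    IntegrableOn (fun r : ℝ => r ^ (-β) / (r + σ)) (Ioi 0) := by
  rw [← Ioc_union_Ioi_eq_Ioi zero_le_one]
  have hm : Measurable fun r : ℝ => r ^ (-β) / (r + σ) := by fun_prop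
  refine IntegrableOn.union ?_ ?_
  · have h : IntegrableOn (fun r : ℝ => r ^ (-β) / σ) (Ioc 0 1) :=
      ((intervalIntegral.intervalIntegrable_rpow' (by linarith)).1).div_const σ
    refine Integrable.mono' h hm.aestronglyMeasurable ?_
    refine (ae_restrict_iff' measurableSet_Ioc).2 (Eventually.of_forall fun r hr => ?_)
    have hr0 := hr.1
    rw [Real.norm_of_nonneg (by positivity)]
    gcongr
    linarith
  · have h : IntegrableOn (fun r : ℝ => r ^ (-β - 1)) (Ioi 1) :=
      integrableOn_Ioi_rpow_of_lt (by linarith) one_pos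
    refine Integrable.mono' h hm.aestronglyMeasurable ?_
    refine (ae_restrict_iff' measurableSet_Ioi).2 (Eventually.of_forall fun r (hr : 1 < r) => ?_)
    have hr0 : 0 < r := by linarith
    rw [Real.norm_of_nonneg (by positivity), Real.rpow_sub_one hr0.ne']
    gcongr
    linarith

theorem integrableOn_cutDensity_div_add {ν β x σ : ℝ} (hν0 : 0 < ν) (hν1 : ν < 1 / 2) (hβ0 : 0 < β)
    (hβ1 : β < 1) (hx : 0 ≤ x) (hσ : 0 < σ) :
    IntegrableOn (fun r => cutDensity ν β x r / (r + σ)) (Ioi 0) := by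
  refine Integrable.mono' (integrableOn_rpow_div_add hβ0 hβ1 hσ)
    ((measurable_cutDensity ν β x).div (by fun_prop)).aestronglyMeasurable ?_
  refine (ae_restrict_iff' measurableSet_Ioi).2 (Eventually.of_forall fun r (hr : 0 < r) => ?_)
  rw [norm_div, Real.norm_of_nonneg (by linarith : 0 ≤ r + σ), Real.norm_eq_abs]
  refine div_le_div_of_nonneg_right ((abs_cutDensity_le hr).trans ?_) (by linarith)
  refine mul_le_of_le_one_right (by positivity) (Real.exp_le_one_iff.2 ?_)
  have := (cos_pi_mul_pos hν0 hν1).le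
  have : 0 ≤ x * Real.cos (Real.pi * ν) * r ^ ν := by positivity
  linarith

/-- Fubini: the t-integral of e^(-(r+σ)t) is 1/(r+σ), so an iterated Laplace transform becomes a
Stieltjes transform of the density. -/
theorem integral_exp_mul_wrightKernel {ν β x σ : ℝ} (hν0 : 0 < ν) (hν1 : ν < 1 / 2) (hβ0 : 0 < β)
    (hβ1 : β < 1) (hx : 0 ≤ x) (hσ : 0 < σ) :
    ∫ t in Ioi (0 : ℝ), Real.exp (-(σ * t)) * wrightKernel ν β x t =
      1 / Real.pi * ∫ r in Ioi (0 : ℝ), cutDensity ν β x r / (r + σ) := by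
  have hexp : ∀ r : ℝ, 0 < r → IntegrableOn (fun t => Real.exp (-((r + σ) * t))) (Ioi 0) ∧
      ∫ t in Ioi (0 : ℝ), Real.exp (-((r + σ) * t)) = 1 / (r + σ) := fun r hr => by
    have h1 := integrableOn_exp_mul_Ioi (a := -(r + σ)) (by linarith) 0
    have h2 := integral_exp_mul_Ioi (a := -(r + σ)) (by linarith) 0
    simp only [neg_mul] at h1 h2
    refine ⟨h1, h2.trans ?_⟩
    rw [mul_zero, neg_zero, Real.exp_zero, neg_div_neg_eq]
  have hprod : Integrable (Function.uncurry fun r t : ℝ =>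
      Real.exp (-((r + σ) * t)) * cutDensity ν β x r)
      ((volume.restrict (Ioi 0)).prod (volume.restrict (Ioi 0))) := by
    have hm : Measurable (Function.uncurry fun r t : ℝ =>
        Real.exp (-((r + σ) * t)) * cutDensity ν β x r) := by
      have : Measurable fun p : ℝ × ℝ => cutDensity ν β x p.1 :=
        (measurable_cutDensity ν β x).comp measurable_fst
      exact Measurable.mul (by fun_prop) this
    rw [integrable_prod_iff hm.aestronglyMeasurable]
    constructor
    · refine (ae_restrict_iff' measurableSet_Ioi).2 (Eventually.of_forall fun r hr => ?_)
      exact Integrable.mul_const (hexp r hr).1 (cutDensity ν β x r)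
    · refine (integrableOn_congr_fun ?_ measurableSet_Ioi).1
        (integrableOn_cutDensity_div_add hν0 hν1 hβ0 hβ1 hx hσ).norm
      intro r (hr : 0 < r)
      simp only [Function.uncurry, norm_mul, norm_div, Real.norm_of_nonneg (Real.exp_pos _).le]
      rw [integral_mul_const, (hexp r hr).2, Real.norm_of_nonneg (by linarith : 0 ≤ r + σ)]
      ring
  have h := integral_integral_swap hprod
  rw [setIntegral_congr_fun (g := fun t => 1 / Real.pi * ∫ r in Ioi (0 : ℝ),
    Real.exp (-((r + σ) * t)) * cutDensity ν β x r) measurableSet_Ioi, integral_const_mul, ← h]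
  · congr 1
    refine setIntegral_congr_fun measurableSet_Ioi fun r hr => ?_
    rw [integral_mul_const, (hexp r hr).2]
    ring
  · intro t ht
    simp only
    rw [wrightKernel_eq_integral hν0 (by linarith) hβ1 x ht, mul_left_comm, ← integral_const_mul]
    congr 1
    refine setIntegral_congr_fun measurableSet_Ioi fun r _ => ?_
    rw [← mul_assoc, ← Real.exp_add]
    congr 2
    ring

/-- The case x = 0 of the previous formula: the kernel is then t^(β-1)/Γ(β), whose transform at σ =
1 equals 1. The value ν = 1/4 is arbitrary. -/
theorem integral_rpow_div_add_one {β : ℝ} (hβ0 : 0 < β) (hβ1 : β < 1) :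
    Real.sin (Real.pi * β) * ∫ r in Ioi (0 : ℝ), r ^ (-β) / (r + 1) = Real.pi := by
  have h := integral_exp_mul_wrightKernel (ν := 1 / 4) (x := 0) (by norm_num) (by norm_num) hβ0 hβ1
    le_rfl one_pos
  have h1 : ∫ t in Ioi (0 : ℝ), Real.exp (-(1 * t)) * wrightKernel (1 / 4) β 0 t = 1 := by
    have hG := Real.Gamma_pos_of_pos hβ0
    calc ∫ t in Ioi (0 : ℝ), Real.exp (-(1 * t)) * wrightKernel (1 / 4) β 0 t
        = ∫ t in Ioi (0 : ℝ), Real.exp (-t) * t ^ (β - 1) * (1 / Real.Gamma β) := by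
          refine setIntegral_congr_fun measurableSet_Ioi fun t _ => ?_
          simp only [wrightKernel, zero_div, neg_zero, wright_zero, one_mul]
          ring
      _ = 1 := by
          rw [integral_mul_const, ← Real.Gamma_eq_integral hβ0, mul_one_div_cancel hG.ne']
  rw [h1, eq_comm, one_div_mul_eq_div, div_eq_one_iff_eq Real.pi_ne_zero] at h
  rw [← integral_const_mul]
  refine Eq.trans (setIntegral_congr_fun measurableSet_Ioi fun t _ => ?_) h
  simp only [cutDensity, zero_mul, neg_zero, Real.exp_zero, add_zero]
  ring

/-! ### Contour evaluation of the Laplace transform -/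

/-- The numerator of the contour integrand. -/
noncomputable def contourNum (ν β x : ℝ) (w : ℂ) : ℂ :=
  (Complex.exp (-(x : ℂ) * Complex.exp ((ν : ℂ) * w)) - Complex.exp (-(x : ℂ))) *
    Complex.exp ((1 - (β : ℂ)) * w)

/-- The contour integrand `(exp (-x e^{νw}) - exp (-x)) e^{(1-β)w} / (e^w - 1)`, with its removable
singularity at `w = 0` removed. -/
noncomputable def contourIntegrand (ν β x : ℝ) (w : ℂ) : ℂ :=
  dslope (contourNum ν β x) 0 w / dslope (fun w => Complex.exp w - 1) 0 w

theorem differentiable_contourNum (ν β x : ℝ) : Differentiable ℂ (contourNum ν β x) := by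
  unfold contourNum
  fun_prop

theorem contourIntegrand_of_ne {ν β x : ℝ} {w : ℂ} (hw : w ≠ 0) :
    contourIntegrand ν β x w = contourNum ν β x w / (Complex.exp w - 1) := by
  unfold contourIntegrand
  rw [dslope_of_ne _ hw, dslope_of_ne _ hw, slope_def_field, slope_def_field,
    div_div_div_cancel_right₀ (sub_ne_zero.2 hw)]
  simp [contourNum]

theorem dslope_exp_sub_one_ne_zero {w : ℂ} (hw : |w.im| ≤ Real.pi) :
    dslope (fun w => Complex.exp w - 1) 0 w ≠ 0 := by
  by_cases h0 : w = 0
  · subst h0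
    rw [dslope_same]
    simp
  · rw [dslope_of_ne _ h0, slope_def_field]
    refine div_ne_zero ?_ (sub_ne_zero.2 h0)
    simp only [Complex.exp_zero, sub_self, sub_zero]
    intro h
    obtain ⟨n, hn⟩ := Complex.exp_eq_one_iff.1 (sub_eq_zero.1 h)
    have him : w.im = n * (2 * Real.pi) := by
      rw [hn]; simp
    have hn0 : n = 0 := by
      by_contra hne
      have h1 : (1 : ℝ) ≤ |(n : ℝ)| := by exact_mod_cast Int.one_le_abs hne
      have hpi := Real.pi_pos
      rw [him, abs_mul, abs_of_pos (by positivity : 0 < 2 * Real.pi)] at hw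
      nlinarith
    exact h0 (by rw [hn, hn0]; simp)

theorem continuousAt_contourIntegrand {ν β x : ℝ} {w : ℂ} (hw : |w.im| ≤ Real.pi) :
    ContinuousAt (contourIntegrand ν β x) w := by
  have hc : ∀ f : ℂ → ℂ, Differentiable ℂ f → ContinuousAt (dslope f 0) w := by
    intro f hf
    by_cases h0 : w = 0
    · rw [h0]; exact continuousAt_dslope_same.2 (hf 0)
    · exact (continuousAt_dslope_of_ne h0).2 (hf w).continuousAt
  exact (hc _ (differentiable_contourNum ν β x)).div (hc _ (by fun_prop))
    (dslope_exp_sub_one_ne_zero hw)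

theorem differentiableAt_contourIntegrand {ν β x : ℝ} {w : ℂ} (hw : |w.im| ≤ Real.pi)
    (h0 : w ≠ 0) : DifferentiableAt ℂ (contourIntegrand ν β x) w := by
  have hc : ∀ f : ℂ → ℂ, Differentiable ℂ f → DifferentiableAt ℂ (dslope f 0) w := fun f hf =>
    (differentiableAt_dslope_of_ne h0).2 (hf w)
  exact (hc _ (differentiable_contourNum ν β x)).div (hc _ (by fun_prop))
    (dslope_exp_sub_one_ne_zero hw)

/-- In the strip |Im w| ≤ π the angle ν Im w stays within (-π/2, π/2), so e^(νw) has nonnegative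
real part and the inner exponential is bounded by 1. -/
theorem norm_contourNum_le {ν β x : ℝ} (hν0 : 0 < ν) (hν1 : ν < 1 / 2) (hx : 0 ≤ x) {w : ℂ}
    (hw : |w.im| ≤ Real.pi) : ‖contourNum ν β x w‖ ≤ 2 * Real.exp ((1 - β) * w.re) := by
  have hre : ((1 - (β : ℂ)) * w).re = (1 - β) * w.re := by simp
  have h1 : ‖Complex.exp (-(x : ℂ) * Complex.exp ((ν : ℂ) * w))‖ ≤ 1 := by
    rw [Complex.norm_exp, Real.exp_le_one_iff, ← Complex.ofReal_neg, Complex.re_ofReal_mul,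
      Complex.exp_re, Complex.re_ofReal_mul, Complex.im_ofReal_mul]
    have hpi := Real.pi_pos
    have hcos : 0 ≤ Real.cos (ν * w.im) := by
      refine Real.cos_nonneg_of_mem_Icc ⟨?_, ?_⟩ <;> nlinarith [abs_le.1 hw]
    have : 0 ≤ x * (Real.exp (ν * w.re) * Real.cos (ν * w.im)) := by positivity
    linarith
  have h2 : ‖Complex.exp (-(x : ℂ))‖ ≤ 1 := by
    rw [Complex.norm_exp, Real.exp_le_one_iff]
    simpa using hx
  rw [contourNum, norm_mul, Complex.norm_exp ((1 - (β : ℂ)) * w), hre]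
  refine mul_le_mul_of_nonneg_right ((norm_sub_le _ _).trans ?_) (Real.exp_pos _).le
  linarith

theorem norm_contourIntegrand_le {ν β x : ℝ} (hν0 : 0 < ν) (hν1 : ν < 1 / 2) (hx : 0 ≤ x) {w : ℂ}
    (hw : |w.im| ≤ Real.pi) (hre : w.re ≠ 0) :
    ‖contourIntegrand ν β x w‖ ≤ 2 * Real.exp ((1 - β) * w.re) / |Real.exp w.re - 1| := by
  have h0 : w ≠ 0 := fun h => hre (by simp [h])
  rw [contourIntegrand_of_ne h0, norm_div]
  have h1 : 0 < |Real.exp w.re - 1| := abs_pos.2 (sub_ne_zero.2 (by simpa using hre))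
  have h2 : |Real.exp w.re - 1| ≤ ‖Complex.exp w - 1‖ := by
    simpa [Complex.norm_exp] using abs_norm_sub_norm_le (Complex.exp w) 1
  gcongr
  exact norm_contourNum_le hν0 hν1 hx hw

theorem contourIntegrand_conj {ν β x : ℝ} {w : ℂ} (hw : w ≠ 0) :
    contourIntegrand ν β x (starRingEnd ℂ w) = starRingEnd ℂ (contourIntegrand ν β x w) := by
  rw [contourIntegrand_of_ne hw, contourIntegrand_of_ne (by simpa using hw)]
  simp [contourNum, ← Complex.exp_conj]

/-- The imaginary part of the contour integrand on the line `Im w = π`. -/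
theorem contourIntegrand_im {ν β x : ℝ} (u : ℝ) :
    (contourIntegrand ν β x (u + Real.pi * Complex.I)).im =
      -(Real.exp u * ((cutDensity ν β x (Real.exp u) -
        Real.exp (-x) * (Real.sin (Real.pi * β) * Real.exp u ^ (-β))) / (Real.exp u + 1))) := by
  have h0 : (u + Real.pi * Complex.I : ℂ) ≠ 0 := fun h => by
    have := congrArg Complex.im h
    simp [Real.pi_ne_zero] at this
  have hne : Real.exp u + 1 ≠ 0 := by positivity
  have hden : Complex.exp (u + Real.pi * Complex.I) - 1 = ((-(Real.exp u + 1) : ℝ) : ℂ) := by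
    rw [Complex.exp_add, Complex.exp_pi_mul_I]; push_cast; ring
  rw [contourIntegrand_of_ne h0, hden, Complex.div_ofReal_im]
  have hnum : (contourNum ν β x (u + Real.pi * Complex.I)).im =
      Real.exp u * (cutDensity ν β x (Real.exp u) -
        Real.exp (-x) * (Real.sin (Real.pi * β) * Real.exp u ^ (-β))) := by
    have e1 : (ν : ℂ) * (u + Real.pi * Complex.I) =
        ((ν * u : ℝ) : ℂ) + ((Real.pi * ν : ℝ) : ℂ) * Complex.I := by push_cast; ring
    have e2 : (1 - (β : ℂ)) * (u + Real.pi * Complex.I) =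
        (((1 - β) * u : ℝ) : ℂ) + ((Real.pi - Real.pi * β : ℝ) : ℂ) * Complex.I := by
      push_cast; ring
    have e3 : -(x : ℂ) * Complex.exp ((ν : ℂ) * (u + Real.pi * Complex.I)) =
        ((-(x * Real.exp (ν * u) * Real.cos (Real.pi * ν)) : ℝ) : ℂ) +
          ((-(x * Real.exp (ν * u) * Real.sin (Real.pi * ν)) : ℝ) : ℂ) * Complex.I := by
      rw [e1, Complex.exp_add, Complex.exp_mul_I]; push_cast; ring
    rw [contourNum, sub_mul, e3, e2, ← Complex.exp_add, ← Complex.exp_add, Complex.sub_im,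
      Complex.exp_im, Complex.exp_im]
    simp only [Complex.add_re, Complex.add_im, Complex.ofReal_re, Complex.ofReal_im,
      Complex.re_ofReal_mul, Complex.im_ofReal_mul, Complex.I_re, Complex.I_im, Complex.neg_re,
      Complex.neg_im, mul_zero, mul_one, add_zero, zero_add, neg_zero]
    unfold cutDensity
    rw [← Real.exp_mul, ← Real.exp_mul, mul_comm u ν,
      show (-(x * Real.exp (ν * u) * Real.sin (Real.pi * ν)) + (Real.pi - Real.pi * β)) =
      Real.pi - (Real.pi * β + x * Real.exp (ν * u) * Real.sin (Real.pi * ν)) by ring,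
      Real.sin_pi_sub, Real.sin_pi_sub, Real.exp_add, Real.exp_add,
      show (1 - β) * u = u + u * -β by ring, Real.exp_add]
    ring
  rw [hnum]
  field_simp

theorem integral_comp_exp_mul_exp (g : ℝ → ℝ) (hg : IntegrableOn g (Ioi 0)) :
    Integrable (fun u => Real.exp u * g (Real.exp u)) ∧
      ∫ u, Real.exp u * g (Real.exp u) = ∫ r in Ioi (0 : ℝ), g r := by
  have himg : Real.exp '' univ = Ioi 0 := by rw [image_univ, Real.range_exp]
  have hd : ∀ u ∈ univ, HasDerivWithinAt Real.exp (Real.exp u) univ u := fun u _ =>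
    (Real.hasDerivAt_exp u).hasDerivWithinAt
  have h1 := integrableOn_image_iff_integrableOn_abs_deriv_smul MeasurableSet.univ hd
    Real.exp_injective.injOn g
  have h2 := integral_image_eq_integral_abs_deriv_smul MeasurableSet.univ hd
    Real.exp_injective.injOn g
  simp only [himg, Real.abs_exp, smul_eq_mul, integrableOn_univ, setIntegral_univ] at h1 h2
  exact ⟨h1.1 hg, h2.symm⟩

theorem tendsto_exp_mul_div_exp_sub_one {b : ℝ} (hb : b < 1) :
    Tendsto (fun R : ℝ => 2 * Real.exp (b * R) / |Real.exp R - 1|) atTop (𝓝 0) := by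
  have h1 : Tendsto (fun R : ℝ => Real.exp (-((1 - b) * R))) atTop (𝓝 0) :=
    Real.tendsto_exp_neg_atTop_nhds_zero.comp (tendsto_id.const_mul_atTop (by linarith))
  have h2 := (h1.const_mul 2).div (tendsto_const_nhds.sub Real.tendsto_exp_neg_atTop_nhds_zero)
    (by norm_num : (1 : ℝ) - 0 ≠ 0)
  simp only [mul_zero, zero_div] at h2
  refine h2.congr' ?_
  filter_upwards [eventually_gt_atTop 0] with R hR
  have h3 : 1 < Real.exp R := Real.one_lt_exp_iff.2 hR
  simp only [Pi.div_apply]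
  rw [abs_of_pos (by linarith), show -((1 - b) * R) = b * R + -R by ring, Real.exp_add,
    Real.exp_neg]
  have : Real.exp R - 1 ≠ 0 := by linarith
  have : (1 : ℝ) - (Real.exp R)⁻¹ ≠ 0 := by
    have := inv_lt_one_of_one_lt₀ h3
    linarith
  field_simp

/-- Under r = e^u the integrand is, up to sign, the imaginary part of `contourIntegrand` on Im w =
π; on Im w = -π the integrand takes conjugate values. Cauchy's theorem on [-R, R] × [-π, π] equates
the difference of the horizontal sides with that of the vertical ones, which tend to 0 because 0 < β
< 1. Subtracting exp(-x) in the numerator removes the pole at w = 0. -/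
theorem integral_cutDensity_sub {ν β x : ℝ} (hν0 : 0 < ν) (hν1 : ν < 1 / 2) (hβ0 : 0 < β)
    (hβ1 : β < 1) (hx : 0 ≤ x) :
    ∫ r in Ioi (0 : ℝ), (cutDensity ν β x r -
      Real.exp (-x) * (Real.sin (Real.pi * β) * r ^ (-β))) / (r + 1) = 0 := by
  set k : ℝ → ℝ := fun r => (cutDensity ν β x r -
      Real.exp (-x) * (Real.sin (Real.pi * β) * r ^ (-β))) / (r + 1) with hk
  have hpi := Real.pi_pos
  have hki : IntegrableOn k (Ioi 0) := by
    have h1 := integrableOn_cutDensity_div_add hν0 hν1 hβ0 hβ1 hx one_pos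
    have h2 := (integrableOn_rpow_div_add hβ0 hβ1 one_pos).const_mul
      (Real.exp (-x) * Real.sin (Real.pi * β))
    refine (h1.sub h2).congr (Eventually.of_forall fun r => ?_)
    simp only [hk, Pi.sub_apply]
    ring
  obtain ⟨hint, hval⟩ := integral_comp_exp_mul_exp k hki
  rw [← hval]
  have hlim := intervalIntegral_tendsto_integral hint tendsto_neg_atTop_atBot tendsto_id
  refine tendsto_nhds_unique hlim ?_
  have hB := ((tendsto_exp_mul_div_exp_sub_one (b := 1 - β) (by linarith)).add
    (tendsto_exp_mul_div_exp_sub_one (b := β) hβ1)).mul_const Real.pi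
  simp only [add_zero, zero_mul] at hB
  refine squeeze_zero_norm' ?_ hB
  filter_upwards [eventually_gt_atTop 0] with R hR
  -- At the removed singularity continuity is enough, hence the exceptional set {0}.
  have hrect := Complex.integral_boundary_rect_eq_zero_of_differentiable_on_off_countable
    (contourIntegrand ν β x) (-R + -Real.pi * Complex.I) (R + Real.pi * Complex.I) {0}
    (countable_singleton 0)
  simp only [Complex.add_re, Complex.add_im, Complex.neg_re, Complex.neg_im, Complex.ofReal_re,
    Complex.ofReal_im, Complex.mul_re, Complex.mul_im, Complex.I_re, Complex.I_im, mul_zero,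
    mul_one, add_zero, zero_add, neg_zero, sub_self, neg_mul] at hrect
  have hstrip : ∀ w : ℂ, w.im ∈ Icc (-Real.pi) Real.pi → |w.im| ≤ Real.pi := fun w hw =>
    abs_le.2 hw
  have hzero := hrect ?_ ?_
  · have hvert : ∀ S : ℝ, S ≠ 0 → ‖∫ y in (-Real.pi)..Real.pi,
        contourIntegrand ν β x (S + y * Complex.I)‖ ≤
        2 * Real.exp ((1 - β) * S) / |Real.exp S - 1| * (2 * Real.pi) := by
      intro S hS
      have := intervalIntegral.norm_integral_le_of_norm_le_const (a := -Real.pi) (b := Real.pi)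
        (f := fun y : ℝ => contourIntegrand ν β x (S + y * Complex.I))
        (C := 2 * Real.exp ((1 - β) * S) / |Real.exp S - 1|) ?_
      · rwa [sub_neg_eq_add, ← two_mul,
          abs_of_pos (by positivity : (0 : ℝ) < 2 * Real.pi)] at this
      · intro y hy
        rw [uIoc_of_le (by linarith)] at hy
        have := norm_contourIntegrand_le (β := β) hν0 hν1 hx (w := S + y * Complex.I)
          (by simpa using abs_le.2 ⟨hy.1.le, hy.2⟩) (by simpa using hS)
        simpa using this
    have hhor : (∫ u in (-R)..R, contourIntegrand ν β x (u + ((-Real.pi : ℝ) : ℂ) * Complex.I)) -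
        ∫ u in (-R)..R, contourIntegrand ν β x (u + Real.pi * Complex.I) =
        ((2 * ∫ u in (-R)..R, Real.exp u * k (Real.exp u) : ℝ) : ℂ) * Complex.I := by
      have hline : ∀ θ : ℝ, |θ| ≤ Real.pi → IntervalIntegrable
          (fun u : ℝ => contourIntegrand ν β x (u + (θ : ℂ) * Complex.I)) volume (-R) R := by
        intro θ hθ
        refine Continuous.intervalIntegrable (continuous_iff_continuousAt.2 fun u => ?_) _ _
        refine ContinuousAt.comp (f := fun u : ℝ => (u : ℂ) + (θ : ℂ) * Complex.I)
          (continuousAt_contourIntegrand ?_) (by fun_prop)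
        simpa using hθ
      rw [← intervalIntegral.integral_sub (hline _ (by rw [abs_neg, abs_of_pos hpi]))
        (hline _ (by rw [abs_of_pos hpi])), ← intervalIntegral.integral_const_mul,
        ← intervalIntegral.integral_ofReal, ← intervalIntegral.integral_mul_const]
      refine intervalIntegral.integral_congr fun u _ => ?_
      have h0 : (u + Real.pi * Complex.I : ℂ) ≠ 0 := fun h => by
        have := congrArg Complex.im h
        simp [Real.pi_ne_zero] at this
      have hc := contourIntegrand_conj (ν := ν) (β := β) (x := x) h0
      have e1 : starRingEnd ℂ (u + Real.pi * Complex.I) =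
          u + ((-Real.pi : ℝ) : ℂ) * Complex.I := by simp
      rw [e1] at hc
      rw [hc, ← neg_sub, Complex.sub_conj, contourIntegrand_im]
      simp only [hk]
      push_cast
      ring
    rw [hhor] at hzero
    have h1 := hvert R hR.ne'
    have h2 := hvert (-R) (neg_ne_zero.2 hR.ne')
    -- The bound on the left side is the bound on the right side with 1 - β replaced by β.
    have h3 : 2 * Real.exp ((1 - β) * -R) / |Real.exp (-R) - 1| =
        2 * Real.exp (β * R) / |Real.exp R - 1| := by
      have h4 : 1 < Real.exp R := Real.one_lt_exp_iff.2 hR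
      have h5 : |Real.exp (-R) - 1| = Real.exp (-R) * |Real.exp R - 1| := by
        rw [← abs_of_pos (Real.exp_pos (-R)), ← abs_mul, mul_sub, abs_of_pos (Real.exp_pos (-R)),
          ← Real.exp_add, neg_add_cancel, Real.exp_zero, mul_one, abs_sub_comm]
      rw [h5, show (1 - β) * -R = -R + β * R by ring, Real.exp_add, mul_left_comm,
        mul_div_mul_left _ _ (Real.exp_pos _).ne']
    rw [h3] at h2
    set V₁ := ∫ y in (-Real.pi)..Real.pi, contourIntegrand ν β x (R + y * Complex.I)
    set V₂ := ∫ y in (-Real.pi)..Real.pi, contourIntegrand ν β x (((-R : ℝ) : ℂ) + y * Complex.I)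
    have h6 : ((2 * ∫ u in (-R)..R, Real.exp u * k (Real.exp u) : ℝ) : ℂ) * Complex.I =
        Complex.I * (V₂ - V₁) := by
      simp only [smul_eq_mul] at hzero
      linear_combination hzero
    have h7 := congrArg norm h6
    rw [norm_mul, norm_mul, Complex.norm_I, one_mul, mul_one, Complex.norm_real, norm_mul,
      Real.norm_of_nonneg zero_le_two] at h7
    have h8 := norm_sub_le V₂ V₁
    simp only [id]
    linarith
  · intro w hw
    rw [Complex.mem_reProdIm, uIcc_of_le (by linarith : -Real.pi ≤ Real.pi)] at hw
    exact (continuousAt_contourIntegrand (hstrip w hw.2)).continuousWithinAt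
  · intro w hw
    obtain ⟨hw, h0⟩ := hw
    rw [Complex.mem_reProdIm, min_eq_left (by linarith : -Real.pi ≤ Real.pi),
      max_eq_right (by linarith : -Real.pi ≤ Real.pi)] at hw
    exact differentiableAt_contourIntegrand (hstrip w ⟨hw.2.1.le, hw.2.2.le⟩) h0

theorem integral_cutDensity_div_add_one {ν β x : ℝ} (hν0 : 0 < ν) (hν1 : ν < 1 / 2) (hβ0 : 0 < β)
    (hβ1 : β < 1) (hx : 0 ≤ x) :
    ∫ r in Ioi (0 : ℝ), cutDensity ν β x r / (r + 1) = Real.pi * Real.exp (-x) := by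
  have h := integral_cutDensity_sub hν0 hν1 hβ0 hβ1 hx
  have h1 := integrableOn_cutDensity_div_add hν0 hν1 hβ0 hβ1 hx one_pos
  have h2 := (integrableOn_rpow_div_add hβ0 hβ1 one_pos).const_mul
    (Real.exp (-x) * Real.sin (Real.pi * β))
  have h3 := integral_sub h1 h2
  rw [integral_const_mul, mul_assoc, integral_rpow_div_add_one hβ0 hβ1] at h3
  have h4 : ∫ r in Ioi (0 : ℝ), (cutDensity ν β x r / (r + 1) -
      Real.exp (-x) * Real.sin (Real.pi * β) * (r ^ (-β) / (r + 1))) = 0 := by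
    refine Eq.trans ?_ h
    congr 1
    funext r
    ring
  linarith

/-- The scaling r ↦ σr of the density reduces the claim to σ = 1 with x replaced by xσ^ν. -/
theorem laplace_wrightKernel {ν β x σ : ℝ} (hν0 : 0 < ν) (hν1 : ν < 1 / 2) (hβ0 : 0 < β)
    (hβ1 : β < 1) (hx : 0 ≤ x) (hσ : 0 < σ) :
    ∫ t in Ioi (0 : ℝ), Real.exp (-(σ * t)) * wrightKernel ν β x t =
      σ ^ (-β) * Real.exp (-(x * σ ^ ν)) := by
  rw [integral_exp_mul_wrightKernel hν0 hν1 hβ0 hβ1 hx hσ]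
  have h := integral_comp_mul_left_Ioi (fun r => cutDensity ν β x r / (r + σ)) 0 hσ
  rw [mul_zero, smul_eq_mul, inv_mul_eq_div, eq_div_iff hσ.ne'] at h
  rw [← h, setIntegral_congr_fun (g := fun r => σ ^ (-β) / σ *
    (cutDensity ν β (x * σ ^ ν) r / (r + 1))) measurableSet_Ioi, integral_const_mul,
    integral_cutDensity_div_add_one hν0 hν1 hβ0 hβ1 (by positivity)]
  · have := Real.pi_ne_zero
    field_simp
  · intro r (hr : 0 < r)
    simp only
    rw [cutDensity_mul hσ hr]
    have : r + 1 ≠ 0 := by linarith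
    have h2 : σ * r + σ ≠ 0 := by nlinarith
    field_simp

/-! ### Completely monotone sequences -/

/-- The backward difference `a k - a (k + 1)` of a sequence. -/
def backDiff (a : ℕ → ℝ) (k : ℕ) : ℝ := a k - a (k + 1)

/-- Completely monotone sequences. -/
def IsCompletelyMonotone (a : ℕ → ℝ) : Prop := ∀ m k : ℕ, 0 ≤ (backDiff^[m] a) k

theorem backDiff_iterate_add (m : ℕ) : ∀ a b : ℕ → ℝ,
    backDiff^[m] (a + b) = backDiff^[m] a + backDiff^[m] b := by
  induction m with
  | zero => intro a b; rfl
  | succ m ih =>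
    intro a b
    rw [Function.iterate_succ_apply, Function.iterate_succ_apply, Function.iterate_succ_apply, ← ih]
    congr 1
    funext k
    simp only [backDiff, Pi.add_apply]
    ring

namespace IsCompletelyMonotone

variable {a b : ℕ → ℝ}

theorem backDiff (ha : IsCompletelyMonotone a) : IsCompletelyMonotone (backDiff a) := fun m k => by
  simpa only [Function.iterate_succ_apply] using ha (m + 1) k

theorem shift (ha : IsCompletelyMonotone a) : IsCompletelyMonotone fun k => a (k + 1) := by
  have h : ∀ m : ℕ, ∀ a : ℕ → ℝ, ∀ k,
      (_root_.backDiff^[m] fun k => a (k + 1)) k = (_root_.backDiff^[m] a) (k + 1) := by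
    intro m
    induction m with
    | zero => intro a k; rfl
    | succ m ih =>
      intro a k
      rw [Function.iterate_succ_apply, Function.iterate_succ_apply, ← ih]
      rfl
  intro m k
  rw [h]
  exact ha m (k + 1)

theorem add (ha : IsCompletelyMonotone a) (hb : IsCompletelyMonotone b) :
    IsCompletelyMonotone (a + b) := fun m k => by
  rw [backDiff_iterate_add]
  exact add_nonneg (ha m k) (hb m k)

/-- Discrete Leibniz rule: the difference of ab is (difference of a)·b + (shift of a)·(difference of
b). Both summands are again products of completely monotone sequences, so the induction runs over
all pairs at once. -/
theorem mul (ha : IsCompletelyMonotone a) (hb : IsCompletelyMonotone b) :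
    IsCompletelyMonotone (a * b) := by
  have h : ∀ m : ℕ, ∀ a b : ℕ → ℝ, IsCompletelyMonotone a → IsCompletelyMonotone b →
      ∀ k, 0 ≤ (_root_.backDiff^[m] (a * b)) k := by
    intro m
    induction m with
    | zero => intro a b ha hb k; exact mul_nonneg (ha 0 k) (hb 0 k)
    | succ m ih =>
      intro a b ha hb k
      have hd : _root_.backDiff (a * b) =
          _root_.backDiff a * b + (fun k => a (k + 1)) * _root_.backDiff b := by
        funext k
        simp only [_root_.backDiff, Pi.add_apply, Pi.mul_apply]
        ring
      rw [Function.iterate_succ_apply, hd, backDiff_iterate_add]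
      exact add_nonneg (ih _ _ ha.backDiff hb k) (ih _ _ ha.shift hb.backDiff k)
  exact fun m k => h m a b ha hb k

theorem const {c : ℝ} (hc : 0 ≤ c) : IsCompletelyMonotone fun _ => c := by
  intro m k
  cases m with
  | zero => exact hc
  | succ m =>
    have h0 : _root_.backDiff (fun _ : ℕ => c) = fun _ => 0 := by
      funext k; simp [_root_.backDiff]
    have hz : ∀ m : ℕ, _root_.backDiff^[m] (fun _ : ℕ => (0 : ℝ)) = fun _ => 0 := by
      intro m
      refine Function.iterate_fixed ?_ m
      funext k; simp [_root_.backDiff]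
    rw [Function.iterate_succ_apply, h0, hz]

theorem pow (ha : IsCompletelyMonotone a) (n : ℕ) : IsCompletelyMonotone fun k => a k ^ n := by
  induction n with
  | zero => simpa using const zero_le_one
  | succ n ih =>
    simp only [pow_succ]
    exact ih.mul ha

theorem of_tendsto {A : ℕ → ℕ → ℝ} (hA : ∀ n, IsCompletelyMonotone (A n))
    (h : ∀ k, Tendsto (fun n => A n k) atTop (𝓝 (a k))) : IsCompletelyMonotone a := by
  have h' : ∀ m : ℕ, ∀ (A : ℕ → ℕ → ℝ) (a : ℕ → ℝ),
      (∀ k, Tendsto (fun n => A n k) atTop (𝓝 (a k))) →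
      ∀ k, Tendsto (fun n => (_root_.backDiff^[m] (A n)) k) atTop
        (𝓝 ((_root_.backDiff^[m] a) k)) := by
    intro m
    induction m with
    | zero => intro A a h; exact h
    | succ m ih =>
      intro A a h
      simp only [Function.iterate_succ_apply]
      exact ih (fun n => _root_.backDiff (A n)) _ fun k => (h k).sub (h (k + 1))
  exact fun m k => ge_of_tendsto' (h' m A a h k) fun n => hA n m k

/-- The Taylor polynomials of exp have nonnegative coefficients; pass to the limit. -/
theorem exp (ha : IsCompletelyMonotone a) : IsCompletelyMonotone fun k => Real.exp (a k) := by
  refine of_tendsto (A := fun n k => ∑ i ∈ Finset.range n, a k ^ i / (i.factorial : ℝ)) ?_ ?_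
  · intro n
    induction n with
    | zero => simpa using const le_rfl
    | succ n ih =>
      simp only [Finset.sum_range_succ]
      refine ih.add ?_
      simp only [div_eq_mul_inv]
      exact (ha.pow n).mul (const (by positivity))
  · intro k
    rw [Real.exp_eq_exp_ℝ]
    exact (NormedSpace.expSeries_div_hasSum_exp (𝔸 := ℝ) (a k)).tendsto_sum_nat

end IsCompletelyMonotone

/-! ### Laplace transforms sampled at the integers -/

section LaplaceSequence

variable {S : Set ℝ} {φ : ℝ → ℝ}

theorem integrableOn_bounded_mul (hS : MeasurableSet S) (hφ : IntegrableOn φ S) {g : ℝ → ℝ}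
    (hg : Continuous g) {C : ℝ} (hC : ∀ t ∈ S, |g t| ≤ C) :
    IntegrableOn (fun t => g t * φ t) S :=
  Integrable.bdd_mul hφ hg.aestronglyMeasurable
    ((ae_restrict_iff' hS).2 (Eventually.of_forall hC))

theorem abs_exp_neg_le_one {t : ℝ} (ht : 0 ≤ t) : |Real.exp (-t)| ≤ 1 := by
  rw [Real.abs_exp, Real.exp_le_one_iff]
  linarith

theorem abs_one_sub_exp_neg_le_one {t : ℝ} (ht : 0 ≤ t) : |1 - Real.exp (-t)| ≤ 1 := by
  have h1 := Real.exp_pos (-t)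
  have h2 : Real.exp (-t) ≤ 1 := Real.exp_le_one_iff.2 (by linarith)
  rw [abs_le]
  constructor <;> linarith

/-- Each difference multiplies the density by 1 - e^(-t). -/
theorem backDiff_iterate_laplace (hS : MeasurableSet S) (hS0 : S ⊆ Ioi 0) (m : ℕ) :
    ∀ φ : ℝ → ℝ, IntegrableOn φ S → ∀ k : ℕ,
    (backDiff^[m] fun k : ℕ => ∫ t in S, Real.exp (-(k * t)) * φ t) k =
      ∫ t in S, Real.exp (-(k * t)) * (1 - Real.exp (-t)) ^ m * φ t := by
  induction m with
  | zero => intro φ _ k; simp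
  | succ m ih =>
    intro φ hφ k
    have hexp : ∀ k : ℕ, IntegrableOn (fun t => Real.exp (-(k * t)) * φ t) S := fun k =>
      integrableOn_bounded_mul hS hφ (by fun_prop) (C := 1) fun t ht =>
        abs_exp_neg_le_one (by have := hS0 ht; have : (0 : ℝ) < t := this; positivity)
    have hφ' : IntegrableOn (fun t => (1 - Real.exp (-t)) * φ t) S :=
      integrableOn_bounded_mul hS hφ (by fun_prop) (C := 1) fun t ht =>
        abs_one_sub_exp_neg_le_one (le_of_lt (hS0 ht))
    have hd : backDiff (fun k : ℕ => ∫ t in S, Real.exp (-(k * t)) * φ t) =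
        fun k : ℕ => ∫ t in S, Real.exp (-(k * t)) * ((1 - Real.exp (-t)) * φ t) := by
      funext k
      rw [backDiff, ← integral_sub (hexp k) (hexp (k + 1))]
      congr 1
      funext t
      rw [show -(((k + 1 : ℕ) : ℝ) * t) = -(k * t) + -t by push_cast; ring, Real.exp_add]
      ring
    rw [Function.iterate_succ_apply, hd, ih _ hφ']
    congr 1
    funext t
    ring

theorem isCompletelyMonotone_laplace (hS : MeasurableSet S) (hS0 : S ⊆ Ioi 0)
    (hφ : IntegrableOn φ S) (hφ0 : ∀ t ∈ S, 0 ≤ φ t) :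
    IsCompletelyMonotone fun k : ℕ => ∫ t in S, Real.exp (-(k * t)) * φ t := by
  intro m k
  rw [backDiff_iterate_laplace hS hS0 m φ hφ]
  refine setIntegral_nonneg hS fun t ht => ?_
  have h2 : Real.exp (-t) ≤ 1 := Real.exp_le_one_iff.2 (by have : 0 < t := hS0 ht; linarith)
  have h3 := hφ0 t ht
  have h4 : 0 ≤ 1 - Real.exp (-t) := by linarith
  positivity

end LaplaceSequence

/-! ### Positivity and uniqueness from integer samples -/

section Positivity

/-- `exp (-t)` as a point of the unit interval, for `t ≥ 0`. -/
noncomputable def expUnit (t : ℝ) : unitInterval := Set.projIcc 0 1 zero_le_one (Real.exp (-t))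

theorem continuous_expUnit : Continuous expUnit := by
  unfold expUnit
  exact continuous_projIcc.comp (by fun_prop)

theorem coe_expUnit {t : ℝ} (ht : 0 ≤ t) : (expUnit t : ℝ) = Real.exp (-t) := by
  unfold expUnit
  rw [Set.projIcc_of_mem zero_le_one ⟨(Real.exp_pos _).le, Real.exp_le_one_iff.2 (by linarith)⟩]

/-- Hausdorff's moment argument in y = e^(-t). A Bernstein basis polynomial y^k (1-y)^(n-k)
integrates against φ to the (n-k)-th difference of the transform at k, which is nonnegative. Uniform
convergence of the Bernstein approximations does the rest. -/
theorem integral_expUnit_mul_nonneg {φ : ℝ → ℝ} (hφ : IntegrableOn φ (Ioi 0))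
    (hcm : IsCompletelyMonotone fun k : ℕ => ∫ t in Ioi (0 : ℝ), Real.exp (-(k * t)) * φ t)
    (g : C(unitInterval, ℝ)) (hg : ∀ y, 0 ≤ g y) :
    0 ≤ ∫ t in Ioi (0 : ℝ), g (expUnit t) * φ t := by
  have hlim := bernsteinApproximation_uniform g
  have hint : ∀ f : C(unitInterval, ℝ), IntegrableOn (fun t => f (expUnit t) * φ t) (Ioi 0) :=
    fun f => integrableOn_bounded_mul measurableSet_Ioi hφ (f.continuous.comp continuous_expUnit)
      fun t _ => f.norm_coe_le_norm (expUnit t)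
  obtain ⟨C, hC⟩ := hlim.norm.bddAbove_range
  have htend : Tendsto (fun n => ∫ t in Ioi (0 : ℝ), bernsteinApproximation n g (expUnit t) * φ t)
      atTop (𝓝 (∫ t in Ioi (0 : ℝ), g (expUnit t) * φ t)) := by
    refine tendsto_integral_of_dominated_convergence (fun t => C * |φ t|)
      (fun n => (hint _).aestronglyMeasurable) (hφ.abs.const_mul C) ?_ ?_
    · refine fun n => Eventually.of_forall fun t => ?_
      rw [norm_mul, Real.norm_eq_abs (φ t)]
      exact mul_le_mul_of_nonneg_right (((bernsteinApproximation n g).norm_coe_le_norm _).trans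
        (hC (mem_range_self n))) (abs_nonneg _)
    · refine Eventually.of_forall fun t => ?_
      exact (((continuous_eval_const (F := C(unitInterval, ℝ)) (expUnit t)).tendsto g).comp hlim).mul_const _
  refine ge_of_tendsto' htend fun n => ?_
  have hterm : ∀ k : Fin (n + 1), IntegrableOn (fun t => g (bernstein.z k) * (n.choose k : ℝ) *
      (Real.exp (-((k : ℕ) * t)) * (1 - Real.exp (-t)) ^ (n - (k : ℕ)) * φ t)) (Ioi 0) := by
    intro k
    refine (integrableOn_bounded_mul measurableSet_Ioi hφ (by fun_prop) (C := 1)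
      fun t (ht : 0 < t) => ?_).const_mul _
    rw [abs_mul, abs_pow]
    exact mul_le_one₀ (abs_exp_neg_le_one (by positivity)) (by positivity)
      (pow_le_one₀ (abs_nonneg _) (abs_one_sub_exp_neg_le_one ht.le))
  rw [setIntegral_congr_fun (g := fun t => ∑ k : Fin (n + 1), g (bernstein.z k) *
    (n.choose k : ℝ) * (Real.exp (-((k : ℕ) * t)) * (1 - Real.exp (-t)) ^ (n - (k : ℕ)) * φ t))
    measurableSet_Ioi, integral_finsetSum _ fun k _ => hterm k]
  · refine Finset.sum_nonneg fun k _ => ?_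
    rw [integral_const_mul, ← backDiff_iterate_laplace measurableSet_Ioi subset_rfl _ φ hφ]
    have := hg (bernstein.z k)
    have := hcm (n - k) k
    positivity
  · intro t (ht : 0 < t)
    simp only
    rw [bernsteinApproximation.apply, Finset.sum_mul]
    refine Finset.sum_congr rfl fun k _ => ?_
    rw [bernstein_apply, coe_expUnit ht.le, smul_eq_mul, ← Real.exp_nat_mul, mul_neg]
    ring

theorem nonneg_of_isCompletelyMonotone_laplace {h : ℝ → ℝ} (hc : ContinuousOn h (Ioi 0))
    (hi : IntegrableOn (fun t => Real.exp (-t) * h t) (Ioi 0))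
    (hcm : IsCompletelyMonotone fun k : ℕ =>
      ∫ t in Ioi (0 : ℝ), Real.exp (-((k + 1 : ℝ) * t)) * h t) {t : ℝ} (ht : 0 < t) :
    0 ≤ h t := by
  by_contra! hneg
  have hcm' : IsCompletelyMonotone fun k : ℕ =>
      ∫ t in Ioi (0 : ℝ), Real.exp (-(k * t)) * (Real.exp (-t) * h t) := by
    convert hcm using 3 with k
    funext t
    rw [← mul_assoc, ← Real.exp_add]
    congr 2
    ring
  set U : Set ℝ := {s | 0 < s ∧ h s < 0} with hU
  have hUo : IsOpen U := hc.isOpen_inter_preimage isOpen_Ioi isOpen_Iio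
  have hlog : ContinuousAt (fun y : ℝ => -Real.log y) (Real.exp (-t)) :=
    (Real.continuousAt_log (Real.exp_pos _).ne').neg
  have hnear : ∀ᶠ y in 𝓝 (Real.exp (-t)), -Real.log y ∈ U := by
    refine hlog.eventually (hUo.mem_nhds ?_)
    simp only [Real.log_exp, neg_neg]
    exact ⟨ht, hneg⟩
  obtain ⟨δ, hδ, hball⟩ := Metric.eventually_nhds_iff.1 hnear
  -- A tent in y = e^(-s) around e^(-t), nonzero only where h is negative. Testing with it gives a
  -- strictly negative integral, against `integral_expUnit_mul_nonneg`.
  let g : C(unitInterval, ℝ) := ⟨fun y => max 0 (δ - |(y : ℝ) - Real.exp (-t)|), by fun_prop⟩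
  have hpos := integral_expUnit_mul_nonneg hi hcm' g fun y => le_max_left _ _
  have hg : ∀ s : ℝ, 0 < s → g (expUnit s) ≠ 0 → s ∈ U := by
    intro s hs hne
    have h1 : |Real.exp (-s) - Real.exp (-t)| < δ := by
      by_contra! hle
      refine hne (max_eq_left ?_)
      rw [coe_expUnit hs.le]
      linarith
    have := hball (y := Real.exp (-s)) (by rwa [Real.dist_eq])
    simpa using this
  have hnonneg : ∀ s ∈ Ioi (0 : ℝ), 0 ≤ -(g (expUnit s) * (Real.exp (-s) * h s)) := by
    intro s hs
    by_cases h0 : g (expUnit s) = 0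
    · simp [h0]
    · have h1 := (hg s hs h0).2
      have h2 : 0 ≤ g (expUnit s) := le_max_left _ _
      have h3 : 0 ≤ g (expUnit s) * (Real.exp (-s) * -h s) :=
        mul_nonneg h2 (mul_nonneg (Real.exp_pos _).le (by linarith))
      linarith
  have hint : IntegrableOn (fun s => -(g (expUnit s) * (Real.exp (-s) * h s))) (Ioi 0) :=
    (integrableOn_bounded_mul measurableSet_Ioi hi (g.continuous.comp continuous_expUnit)
      fun t _ => g.norm_coe_le_norm (expUnit t)).neg
  have hlt := (setIntegral_pos_iff_support_of_nonneg_ae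
    ((ae_restrict_iff' measurableSet_Ioi).2 (Eventually.of_forall hnonneg)) hint).2 ?_
  · rw [integral_neg] at hlt
    linarith
  · have hopen : IsOpen (U ∩ {s | |Real.exp (-s) - Real.exp (-t)| < δ}) :=
      hUo.inter (isOpen_lt (by fun_prop) continuous_const)
    refine (hopen.measure_pos volume ⟨t, ⟨ht, hneg⟩, by simpa using hδ⟩).trans_le
      (measure_mono fun s hs => ⟨?_, hs.1.1⟩)
    have h1 : g (expUnit s) = δ - |Real.exp (-s) - Real.exp (-t)| := by
      have h2 : |Real.exp (-s) - Real.exp (-t)| < δ := hs.2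
      change max 0 (δ - |(expUnit s : ℝ) - Real.exp (-t)|) = _
      rw [coe_expUnit hs.1.1.le, max_eq_right (by linarith)]
    have h2 : |Real.exp (-s) - Real.exp (-t)| < δ := hs.2
    rw [Function.mem_support, neg_ne_zero, h1]
    exact mul_ne_zero (by linarith) (mul_ne_zero (Real.exp_pos _).ne' hs.1.2.ne)

/-- A continuous function is determined by its Laplace transform at the positive integers. -/
theorem eqOn_of_laplace_eq {f g : ℝ → ℝ} (hf : ContinuousOn f (Ioi 0)) (hg : ContinuousOn g (Ioi 0))
    (hfi : ∀ k : ℕ, IntegrableOn (fun t => Real.exp (-((k + 1 : ℝ) * t)) * f t) (Ioi 0))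
    (hgi : ∀ k : ℕ, IntegrableOn (fun t => Real.exp (-((k + 1 : ℝ) * t)) * g t) (Ioi 0))
    (hfg : ∀ k : ℕ, ∫ t in Ioi (0 : ℝ), Real.exp (-((k + 1 : ℝ) * t)) * f t =
      ∫ t in Ioi (0 : ℝ), Real.exp (-((k + 1 : ℝ) * t)) * g t) : EqOn f g (Ioi 0) := by
  have key : ∀ f g : ℝ → ℝ, ContinuousOn f (Ioi 0) → ContinuousOn g (Ioi 0) →
      (∀ k : ℕ, IntegrableOn (fun t => Real.exp (-((k + 1 : ℝ) * t)) * f t) (Ioi 0)) →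
      (∀ k : ℕ, IntegrableOn (fun t => Real.exp (-((k + 1 : ℝ) * t)) * g t) (Ioi 0)) →
      (∀ k : ℕ, ∫ t in Ioi (0 : ℝ), Real.exp (-((k + 1 : ℝ) * t)) * f t =
      ∫ t in Ioi (0 : ℝ), Real.exp (-((k + 1 : ℝ) * t)) * g t) → ∀ t, 0 < t → g t ≤ f t := by
    intro f g hf hg hfi hgi hfg t ht
    have h := nonneg_of_isCompletelyMonotone_laplace (h := fun t => f t - g t) (hf.sub hg) ?_ ?_ ht
    · linarith
    · have := (hfi 0).sub (hgi 0)
      simpa [mul_sub, Pi.sub_def] using this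
    · convert IsCompletelyMonotone.const le_rfl using 2 with k
      simp only [mul_sub]
      rw [integral_sub (hfi k) (hgi k), hfg, sub_self]
  exact fun t ht => le_antisymm (key g f hg hf hgi hfi (fun k => (hfg k).symm) t ht)
    (key f g hf hg hfi hgi hfg t ht)

end Positivity

/-! ### Complete monotonicity of exp(-xσ^ν) and nonnegativity of the kernel -/

section StableExponent

variable {ν : ℝ}

theorem integrableOn_levy (hν0 : 0 < ν) (hν1 : ν < 1) :
    IntegrableOn (fun r : ℝ => (1 - Real.exp (-r)) * r ^ (-1 - ν)) (Ioi 0) := by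
  have hm : Measurable fun r : ℝ => (1 - Real.exp (-r)) * r ^ (-1 - ν) := by fun_prop
  have h0 : ∀ r : ℝ, 0 < r → 0 ≤ 1 - Real.exp (-r) := fun r hr => by
    have : Real.exp (-r) ≤ 1 := Real.exp_le_one_iff.2 (by linarith)
    linarith
  rw [← Ioc_union_Ioi_eq_Ioi zero_le_one]
  refine IntegrableOn.union ?_ ?_
  · have h : IntegrableOn (fun r : ℝ => r ^ (-ν)) (Ioc 0 1) :=
      (intervalIntegral.intervalIntegrable_rpow' (by linarith)).1
    refine Integrable.mono' h hm.aestronglyMeasurable ?_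
    refine (ae_restrict_iff' measurableSet_Ioc).2 (Eventually.of_forall fun r hr => ?_)
    have hr0 := hr.1
    have h1 := h0 r hr0
    rw [Real.norm_of_nonneg (by positivity)]
    have h2 : 1 - Real.exp (-r) ≤ r := by
      have := Real.add_one_le_exp (-r)
      linarith
    calc (1 - Real.exp (-r)) * r ^ (-1 - ν) ≤ r * r ^ (-1 - ν) := by gcongr
      _ = r ^ (-ν) := by
        nth_rewrite 1 [← Real.rpow_one r]
        rw [← Real.rpow_add hr0]
        congr 1
        ring
  · refine Integrable.mono' (integrableOn_Ioi_rpow_of_lt (by linarith : -1 - ν < -1) one_pos)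
      hm.aestronglyMeasurable ?_
    refine (ae_restrict_iff' measurableSet_Ioi).2 (Eventually.of_forall fun r (hr : 1 < r) => ?_)
    have hr0 : 0 < r := by linarith
    have h1 := h0 r hr0
    rw [Real.norm_of_nonneg (by positivity)]
    refine mul_le_of_le_one_left (by positivity) ?_
    have := Real.exp_pos (-r)
    linarith

theorem integral_levy_pos (hν0 : 0 < ν) (hν1 : ν < 1) :
    0 < ∫ r in Ioi (0 : ℝ), (1 - Real.exp (-r)) * r ^ (-1 - ν) := by
  have hpos : ∀ r ∈ Ioi (0 : ℝ), 0 < (1 - Real.exp (-r)) * r ^ (-1 - ν) := fun r (hr : 0 < r) => by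
    have : Real.exp (-r) < 1 := Real.exp_lt_one_iff.2 (by linarith)
    exact mul_pos (by linarith) (by positivity)
  refine (setIntegral_pos_iff_support_of_nonneg_ae ((ae_restrict_iff' measurableSet_Ioi).2
    (Eventually.of_forall fun r hr => (hpos r hr).le)) (integrableOn_levy hν0 hν1)).2 ?_
  have hsub : Ioi 0 ⊆ Function.support fun r : ℝ => (1 - Real.exp (-r)) * r ^ (-1 - ν) :=
    fun r hr => (hpos r hr).ne'
  rw [inter_eq_right.2 hsub]
  exact isOpen_Ioi.measure_pos volume nonempty_Ioi

theorem levy_scaling (σ : ℝ) (hσ : 0 < σ) {r : ℝ} (hr : 0 < r) :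
    (1 - Real.exp (-(σ * r))) * r ^ (-1 - ν) =
      σ ^ (1 + ν) * ((1 - Real.exp (-(σ * r))) * (σ * r) ^ (-1 - ν)) := by
  rw [Real.mul_rpow hσ.le hr.le, mul_left_comm, ← mul_assoc (σ ^ (1 + ν)), ← Real.rpow_add hσ,
    show 1 + ν + (-1 - ν) = 0 by ring, Real.rpow_zero, one_mul]

theorem integrableOn_levy_mul (hν0 : 0 < ν) (hν1 : ν < 1) {σ : ℝ} (hσ : 0 < σ) :
    IntegrableOn (fun r : ℝ => (1 - Real.exp (-(σ * r))) * r ^ (-1 - ν)) (Ioi 0) := by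
  have h := (integrableOn_Ioi_comp_mul_left_iff
    (fun r : ℝ => (1 - Real.exp (-r)) * r ^ (-1 - ν)) 0 hσ).2
    (by rw [mul_zero]; exact integrableOn_levy hν0 hν1)
  exact (integrableOn_congr_fun (fun r hr => (levy_scaling σ hσ hr).symm) measurableSet_Ioi).1
    (h.const_mul (σ ^ (1 + ν)))

/-- Lévy's representation of σ^ν, obtained by scaling alone; the value of the constant is never
needed, only its positivity. -/
theorem integral_levy_mul {σ : ℝ} (hσ : 0 < σ) :
    ∫ r in Ioi (0 : ℝ), (1 - Real.exp (-(σ * r))) * r ^ (-1 - ν) =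
      σ ^ ν * ∫ r in Ioi (0 : ℝ), (1 - Real.exp (-r)) * r ^ (-1 - ν) := by
  rw [setIntegral_congr_fun measurableSet_Ioi fun r hr => levy_scaling (ν := ν) σ hσ hr,
    integral_const_mul, integral_comp_mul_left_Ioi
    (fun r : ℝ => (1 - Real.exp (-r)) * r ^ (-1 - ν)) 0 hσ, mul_zero, smul_eq_mul, ← mul_assoc,
    Real.rpow_add hσ, Real.rpow_one]
  field_simp

/-- Cutting the Lévy integral at r > 1/(n+1) makes r^(-1-ν) integrable. The exponent then splits
into a constant plus a completely monotone Laplace sequence, to which `IsCompletelyMonotone.exp`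
applies. Then n → ∞. -/
theorem isCompletelyMonotone_exp_neg_rpow (hν0 : 0 < ν) (hν1 : ν < 1) {x : ℝ} (hx : 0 ≤ x) :
    IsCompletelyMonotone fun k : ℕ => Real.exp (-(x * (k + 1 : ℝ) ^ ν)) := by
  set c := ∫ r in Ioi (0 : ℝ), (1 - Real.exp (-r)) * r ^ (-1 - ν) with hc
  have hc0 : 0 < c := integral_levy_pos hν0 hν1
  set S : ℕ → Set ℝ := fun n => Ioi (1 / ((n : ℝ) + 1)) with hSdef
  have hS0 : ∀ n, S n ⊆ Ioi 0 := fun n r (hr : _ < r) =>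
    lt_trans (by positivity : (0 : ℝ) < 1 / ((n : ℝ) + 1)) hr
  have hpow : ∀ n, IntegrableOn (fun r : ℝ => r ^ (-1 - ν)) (S n) := fun n =>
    integrableOn_Ioi_rpow_of_lt (by linarith) (by positivity)
  have hexp : ∀ (n : ℕ) (σ : ℝ), 0 < σ →
      IntegrableOn (fun r : ℝ => Real.exp (-(σ * r)) * r ^ (-1 - ν)) (S n) := fun n σ hσ =>
    integrableOn_bounded_mul measurableSet_Ioi (hpow n) (by fun_prop) (C := 1) fun r hr =>
      abs_exp_neg_le_one (by have : 0 < r := hS0 n hr; positivity)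
  refine IsCompletelyMonotone.of_tendsto (A := fun n k => Real.exp (-(x / c *
    ∫ r in S n, (1 - Real.exp (-((k + 1 : ℝ) * r))) * r ^ (-1 - ν)))) ?_ ?_
  · intro n
    have h1 : IsCompletelyMonotone fun k : ℕ =>
        ∫ r in S n, Real.exp (-(k * r)) * (Real.exp (-(1 * r)) * r ^ (-1 - ν)) :=
      isCompletelyMonotone_laplace measurableSet_Ioi (hS0 n) (hexp n 1 one_pos) fun r hr => by
        have : 0 < r := hS0 n hr
        positivity
    have h2 := (IsCompletelyMonotone.const (Real.exp_pos
      (-(x / c * ∫ r in S n, r ^ (-1 - ν)))).le).mul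
      ((IsCompletelyMonotone.const (by positivity : 0 ≤ x / c)).mul h1).exp
    convert h2 using 2 with k
    simp only [Pi.mul_apply]
    rw [← Real.exp_add]
    congr 1
    have h3 : ∫ r in S n, Real.exp (-(k * r)) * (Real.exp (-(1 * r)) * r ^ (-1 - ν)) =
        ∫ r in S n, Real.exp (-((k + 1 : ℝ) * r)) * r ^ (-1 - ν) := by
      congr 1
      funext r
      rw [← mul_assoc, ← Real.exp_add]
      congr 2
      ring
    simp only [sub_mul, one_mul]
    rw [integral_sub (hpow n) (hexp n _ (by positivity))]
    simp only [one_mul] at h3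
    rw [h3]
    ring
  · intro k
    have hmono : Monotone S := fun m n hmn => Ioi_subset_Ioi (by gcongr)
    have hU : ⋃ n, S n = Ioi 0 := by
      refine Subset.antisymm (iUnion_subset hS0) fun r (hr : 0 < r) => mem_iUnion.2 ?_
      obtain ⟨n, hn⟩ := exists_nat_one_div_lt hr
      exact ⟨n, hn⟩
    have h1 := tendsto_setIntegral_of_monotone (μ := volume) (s := S)
      (f := fun r : ℝ => (1 - Real.exp (-((k + 1 : ℝ) * r))) * r ^ (-1 - ν))
      (fun n => measurableSet_Ioi) hmono
      (by rw [hU]; exact integrableOn_levy_mul hν0 hν1 (by positivity))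
    rw [hU, integral_levy_mul (by positivity), ← hc] at h1
    have h2 := (Real.continuous_exp.tendsto _).comp ((h1.const_mul (x / c)).neg)
    rwa [show x / c * ((k + 1 : ℝ) ^ ν * c) = x * (k + 1 : ℝ) ^ ν by field_simp] at h2

theorem isCompletelyMonotone_rpow_neg {β : ℝ} (hβ : 0 < β) :
    IsCompletelyMonotone fun k : ℕ => (k + 1 : ℝ) ^ (-β) := by
  have hG := Real.Gamma_pos_of_pos hβ
  have h1 : IsCompletelyMonotone fun k : ℕ =>
      ∫ t in Ioi (0 : ℝ), Real.exp (-(k * t)) * (Real.exp (-t) * t ^ (β - 1)) :=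
    isCompletelyMonotone_laplace measurableSet_Ioi subset_rfl (Real.GammaIntegral_convergent hβ)
      fun t (ht : 0 < t) => by positivity
  convert (IsCompletelyMonotone.const (by positivity : 0 ≤ 1 / Real.Gamma β)).mul h1 using 2 with k
  have h2 := Real.integral_rpow_mul_exp_neg_mul_Ioi hβ (by positivity : (0 : ℝ) < k + 1)
  have h3 : ∫ t in Ioi (0 : ℝ), Real.exp (-(k * t)) * (Real.exp (-t) * t ^ (β - 1)) =
      (1 / (k + 1 : ℝ)) ^ β * Real.Gamma β := by
    rw [← h2]
    congr 1
    funext t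
    rw [← mul_assoc, ← Real.exp_add, mul_comm]
    congr 2
    ring
  simp only [Pi.mul_apply]
  rw [h3, one_div, one_div, Real.inv_rpow (by positivity), ← Real.rpow_neg (by positivity)]
  field_simp

/-- At σ = k + 1 both factors of the transform σ^(-β) exp(-xσ^ν) are completely monotone in k. -/
theorem wrightKernel_nonneg {β x t : ℝ} (hν0 : 0 < ν) (hν1 : ν < 1 / 2) (hβ0 : 0 < β) (hβ1 : β < 1)
    (hx : 0 < x) (ht : 0 < t) : 0 ≤ wrightKernel ν β x t := by
  refine nonneg_of_isCompletelyMonotone_laplace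
    (continuousOn_wrightKernel_time hν0 (by linarith) β x) ?_ ?_ ht
  · simpa using integrableOn_exp_mul_wrightKernel hν0 hν1 hβ1 hx one_pos
  · convert (isCompletelyMonotone_rpow_neg hβ0).mul
      (isCompletelyMonotone_exp_neg_rpow hν0 (by linarith) hx.le) using 2 with k
    exact laplace_wrightKernel hν0 hν1 hβ0 hβ1 hx.le (by positivity)

end StableExponent

/-! ### Convolution with a power and Riemann–Liouville integration of the kernel -/

section Volterra

variable {f g : ℝ → ℝ} {C : ℝ}

theorem intervalIntegrable_bounded_mul {r : ℝ} (hr : 0 ≤ r) (hf : ContinuousOn f (Ioi 0))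
    (hC : ∀ t, 0 < t → |f t| ≤ C) (hg : IntervalIntegrable g volume 0 r) :
    IntervalIntegrable (fun τ => g τ * f τ) volume 0 r := by
  rw [intervalIntegrable_iff_integrableOn_Ioc_of_le hr] at hg ⊢
  refine Integrable.mul_bdd (c := C) hg ?_ ?_
  · exact (hf.mono fun t ht => ht.1).aestronglyMeasurable measurableSet_Ioc
  · exact (ae_restrict_iff' measurableSet_Ioc).2 (Eventually.of_forall fun t ht => hC t ht.1)

theorem intervalIntegrable_sub_rpow {γ : ℝ} (hγ : 0 < γ) (r : ℝ) :
    IntervalIntegrable (fun τ => (r - τ) ^ (γ - 1)) volume 0 r := by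
  have h := (intervalIntegral.intervalIntegrable_rpow' (a := r) (b := 0) (r := γ - 1)
    (by linarith)).comp_sub_left r
  simpa using h

theorem intervalIntegrable_of_bounded {r : ℝ} (hr : 0 ≤ r) (hf : ContinuousOn f (Ioi 0))
    (hC : ∀ t, 0 < t → |f t| ≤ C) : IntervalIntegrable f volume 0 r := by
  simpa using intervalIntegrable_bounded_mul hr hf hC
    (intervalIntegrable_const (c := (1 : ℝ)) (μ := volume))

theorem hasDerivAt_integral_of_bounded (hf : ContinuousOn f (Ioi 0))
    (hC : ∀ t, 0 < t → |f t| ≤ C) {t : ℝ} (ht : 0 < t) :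
    HasDerivAt (fun r => ∫ τ in (0 : ℝ)..r, f τ) (f t) t :=
  intervalIntegral.integral_hasDerivAt_right (intervalIntegrable_of_bounded ht.le hf hC)
    (hf.stronglyMeasurableAtFilter isOpen_Ioi t ht) (hf.continuousAt (Ioi_mem_nhds ht))

/-- Moves the t-dependence off the singular factor and the endpoint, so that continuity in t follows
by dominated convergence. -/
theorem integral_mul_sub_rpow {γ t : ℝ} (ht : 0 < t) :
    ∫ τ in (0 : ℝ)..t, f τ * (t - τ) ^ (γ - 1) =
      t ^ γ * ∫ y in (0 : ℝ)..1, f (t * y) * (1 - y) ^ (γ - 1) := by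
  have h := intervalIntegral.integral_comp_mul_left (a := 0) (b := 1)
    (fun τ => f τ * (t - τ) ^ (γ - 1)) ht.ne'
  rw [mul_zero, mul_one, smul_eq_mul, inv_mul_eq_div, eq_div_iff ht.ne'] at h
  rw [← h, intervalIntegral.integral_congr (g := fun y => t ^ (γ - 1) *
    (f (t * y) * (1 - y) ^ (γ - 1))), intervalIntegral.integral_const_mul,
    Real.rpow_sub_one ht.ne']
  · field_simp
  · intro y hy
    rw [uIcc_of_le zero_le_one] at hy
    simp only
    rw [show t - t * y = t * (1 - y) by ring, Real.mul_rpow ht.le (by linarith [hy.2])]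
    ring

theorem continuousOn_integral_mul_sub_rpow {γ : ℝ} (hγ : 0 < γ) (hf : ContinuousOn f (Ioi 0))
    (hC : ∀ t, 0 < t → |f t| ≤ C) :
    ContinuousOn (fun t => ∫ τ in (0 : ℝ)..t, f τ * (t - τ) ^ (γ - 1)) (Ioi 0) := by
  refine ContinuousOn.congr (f := fun t => t ^ γ * ∫ y in (0 : ℝ)..1, f (t * y) * (1 - y) ^ (γ - 1))
    ?_ fun t ht => integral_mul_sub_rpow ht
  intro t₀ (ht₀ : 0 < t₀)
  refine ContinuousAt.continuousWithinAt
    ((Real.continuousAt_rpow_const _ _ (Or.inl ht₀.ne')).mul ?_)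
  refine intervalIntegral.continuousAt_of_dominated_interval
    (bound := fun y => C * (1 - y) ^ (γ - 1)) ?_ ?_
    ((intervalIntegrable_sub_rpow hγ 1).const_mul C) ?_
  · filter_upwards [lt_mem_nhds ht₀] with t ht
    rw [uIoc_of_le zero_le_one]
    refine AEStronglyMeasurable.mul ?_ (by fun_prop : Measurable fun y : ℝ =>
      (1 - y) ^ (γ - 1)).aestronglyMeasurable
    exact (hf.comp (by fun_prop) fun y hy => mul_pos ht hy.1).aestronglyMeasurable
      measurableSet_Ioc
  · filter_upwards [lt_mem_nhds ht₀] with t ht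
    refine Eventually.of_forall fun y hy => ?_
    rw [uIoc_of_le zero_le_one] at hy
    have h1 : 0 ≤ 1 - y := by linarith [hy.2]
    rw [norm_mul, Real.norm_of_nonneg (by positivity : 0 ≤ (1 - y) ^ (γ - 1))]
    exact mul_le_mul_of_nonneg_right (hC _ (mul_pos ht hy.1)) (by positivity)
  · refine Eventually.of_forall fun y hy => ?_
    rw [uIoc_of_le zero_le_one] at hy
    refine ContinuousAt.mul ?_ continuousAt_const
    exact ContinuousAt.comp (f := fun t => t * y)
      (hf.continuousAt (Ioi_mem_nhds (mul_pos ht₀ hy.1))) (by fun_prop)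

theorem laplace_convolution {σ : ℝ}
    (hf : IntegrableOn (fun t => Real.exp (-(σ * t)) * f t) (Ioi 0))
    (hg : IntegrableOn (fun t => Real.exp (-(σ * t)) * g t) (Ioi 0)) :
    IntegrableOn (fun t => Real.exp (-(σ * t)) * ∫ τ in (0 : ℝ)..t, f τ * g (t - τ)) (Ioi 0) ∧
    ∫ t in Ioi (0 : ℝ), Real.exp (-(σ * t)) * ∫ τ in (0 : ℝ)..t, f τ * g (t - τ) =
      (∫ t in Ioi (0 : ℝ), Real.exp (-(σ * t)) * f t) *
        ∫ t in Ioi (0 : ℝ), Real.exp (-(σ * t)) * g t := by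
  have h1 := integrable_posConvolution hf hg (ContinuousLinearMap.mul ℝ ℝ)
  have h2 := integral_posConvolution hf hg (ContinuousLinearMap.mul ℝ ℝ)
  rw [posConvolution, integrable_indicator_iff measurableSet_Ioi] at h1
  have h3 : ∀ t : ℝ, ∫ τ in (0 : ℝ)..t, (ContinuousLinearMap.mul ℝ ℝ)
      (Real.exp (-(σ * τ)) * f τ) (Real.exp (-(σ * (t - τ))) * g (t - τ)) =
      Real.exp (-(σ * t)) * ∫ τ in (0 : ℝ)..t, f τ * g (t - τ) := fun t => by
    rw [← intervalIntegral.integral_const_mul]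
    congr 1
    funext τ
    rw [ContinuousLinearMap.mul_apply', show -(σ * t) = -(σ * τ) + -(σ * (t - τ)) by ring,
      Real.exp_add]
    ring
  simp only [h3] at h1 h2
  exact ⟨h1, h2⟩

end Volterra

/-- Riemann--Liouville integration raises the third parameter of the self-similar Wright functions;
the statement is in integrated form. -/
theorem rlIntegral_wrightKernel {ν β γ x : ℝ} (hν0 : 0 < ν) (hν1 : ν < 1 / 2) (hβ0 : 0 < β)
    (hβ1 : β < 1) (hγ : 0 < γ) (h0 : 0 < β + γ - 1) (h1 : β + γ - 1 < 1) (hx : 0 < x) {t : ℝ}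
    (ht : 0 < t) :
    rlIntegral γ (wrightKernel ν β x) t = ∫ τ in (0 : ℝ)..t, wrightKernel ν (β + γ - 1) x τ := by
  have hν1' : ν < 1 := by linarith
  obtain ⟨C, hC⟩ := exists_abs_wrightKernel_le hν0 hν1 hβ1 hx
  obtain ⟨C', hC'⟩ := exists_abs_wrightKernel_le hν0 hν1 h1 hx
  have hc := continuousOn_wrightKernel_time hν0 hν1' β x
  have hc' := continuousOn_wrightKernel_time hν0 hν1' (β + γ - 1) x
  have hG := Real.Gamma_pos_of_pos hγ
  have hpow : ∀ k : ℕ, IntegrableOn (fun t : ℝ => Real.exp (-((k + 1 : ℝ) * t)) * t ^ (γ - 1))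
      (Ioi 0) := fun k => by
    have := integrableOn_rpow_mul_exp_neg_mul_rpow (p := 1) (s := γ - 1) (b := (k : ℝ) + 1)
      (by linarith) one_pos (by positivity)
    simpa only [Real.rpow_one, neg_mul, mul_comm (Real.exp _)] using this
  have hone : ∀ k : ℕ, IntegrableOn (fun t : ℝ => Real.exp (-((k + 1 : ℝ) * t)) * (1 : ℝ))
      (Ioi 0) ∧ ∫ t in Ioi (0 : ℝ), Real.exp (-((k + 1 : ℝ) * t)) * (1 : ℝ) = (k + 1 : ℝ)⁻¹ := by
    intro k
    have h1 := integrableOn_exp_mul_Ioi (a := -((k : ℝ) + 1))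
      (by have : (0 : ℝ) < k + 1 := by positivity
          linarith) 0
    have h2 := integral_exp_mul_Ioi (a := -((k : ℝ) + 1))
      (by have : (0 : ℝ) < k + 1 := by positivity
          linarith) 0
    simp only [neg_mul] at h1 h2
    refine ⟨by simpa using h1, ?_⟩
    simp only [mul_one]
    rw [h2, mul_zero, neg_zero, Real.exp_zero, neg_div_neg_eq, one_div]
  have hA := fun k : ℕ => laplace_convolution
    (integrableOn_exp_mul_wrightKernel hν0 hν1 hβ1 hx (by positivity : (0 : ℝ) < k + 1)) (hpow k)
  have hB := fun k : ℕ => laplace_convolution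
    (integrableOn_exp_mul_wrightKernel hν0 hν1 h1 hx (by positivity : (0 : ℝ) < k + 1)) (hone k).1
  simp only [mul_one] at hB
  -- Both sides have transform Γ(γ) σ^(-β-γ) exp(-xσ^ν). Integrating the kernel of parameter β + γ -
  -- 1 keeps that parameter in (0, 1), where the transform is known; in the application β + γ
  -- exceeds 1.
  have key := eqOn_of_laplace_eq
    (f := fun t => ∫ τ in (0 : ℝ)..t, wrightKernel ν β x τ * (t - τ) ^ (γ - 1))
    (g := fun t => Real.Gamma γ * ∫ τ in (0 : ℝ)..t, wrightKernel ν (β + γ - 1) x τ)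
    (continuousOn_integral_mul_sub_rpow hγ hc hC)
    (continuousOn_const.mul fun t ht =>
      (hasDerivAt_integral_of_bounded hc' hC' ht).continuousAt.continuousWithinAt)
    (fun k => (hA k).1)
    (fun k => by
      simp only [mul_left_comm _ (Real.Gamma γ)]
      exact (hB k).1.const_mul (Real.Gamma γ)) ?_
  · unfold rlIntegral
    have h2 := key ht
    simp only [mul_comm (wrightKernel ν β x _)] at h2
    rw [h2]
    field_simp
  · intro k
    have hk : (0 : ℝ) < k + 1 := by positivity
    have hone' := (hone k).2
    simp only [mul_one] at hone'
    simp only [mul_left_comm _ (Real.Gamma γ)]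
    rw [(hA k).2, integral_const_mul, (hB k).2, laplace_wrightKernel hν0 hν1 hβ0 hβ1 hx.le hk,
      laplace_wrightKernel hν0 hν1 h0 h1 hx.le hk, hone']
    have h3 : ∫ t in Ioi (0 : ℝ), Real.exp (-((k + 1 : ℝ) * t)) * t ^ (γ - 1) =
        ((k : ℝ) + 1) ^ (-γ) * Real.Gamma γ := by
      have := Real.integral_rpow_mul_exp_neg_mul_Ioi hγ hk
      rw [one_div, Real.inv_rpow hk.le, ← Real.rpow_neg hk.le] at this
      rw [← this]
      simp only [mul_comm]
    rw [h3, show -(β + γ - 1) = -β + -γ + 1 by ring, Real.rpow_add hk, Real.rpow_add hk,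
      Real.rpow_one]
    field_simp

/-! ### The similarity equation -/

section Root

variable {ν : ℝ}

theorem hasDerivAt_wright_neg (hν0 : 0 < ν) (hν1 : ν < 1) (β z : ℝ) :
    HasDerivAt (fun z => wright (-z) (-ν) β) (-wright (-z) (-ν) (β - ν)) z := by
  have h := (hasDerivAt_wright hν0 hν1 β (-z)).comp z (hasDerivAt_neg z)
  exact h.congr_deriv (by ring)

theorem mainardi_nonneg (hν0 : 0 < ν) (hν1 : ν < 1 / 2) {z : ℝ} (hz : 0 < z) :
    0 ≤ wright (-z) (-ν) (1 - ν) := by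
  simpa [wrightKernel] using wrightKernel_nonneg (β := 1 - ν) hν0 hν1 (by linarith) (by linarith)
    hz one_pos

theorem antitoneOn_wright_one (hν0 : 0 < ν) (hν1 : ν < 1 / 2) :
    AntitoneOn (fun z => wright (-z) (-ν) 1) (Ici 0) := by
  have hd := hasDerivAt_wright_neg hν0 (by linarith : ν < 1) 1
  refine antitoneOn_of_deriv_nonpos (convex_Ici 0)
    (fun z _ => (hd z).continuousAt.continuousWithinAt)
    (fun z _ => (hd z).differentiableAt.differentiableWithinAt) fun z hz => ?_
  rw [interior_Ici] at hz
  rw [(hd z).deriv]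
  have := mainardi_nonneg hν0 hν1 hz
  linarith

/-- The derivative is -W(-z, -ν, 0), and the recurrence at β = 1 equates this with -νz W(-z, -ν,
1-ν) ≤ 0. -/
theorem antitoneOn_wright_self (hν0 : 0 < ν) (hν1 : ν < 1 / 2) :
    AntitoneOn (fun z => wright (-z) (-ν) ν) (Ici 0) := by
  have hd := hasDerivAt_wright_neg hν0 (by linarith : ν < 1) ν
  refine antitoneOn_of_deriv_nonpos (convex_Ici 0)
    (fun z _ => (hd z).continuousAt.continuousWithinAt)
    (fun z _ => (hd z).differentiableAt.differentiableWithinAt) fun z (hz : z ∈ _) => ?_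
  rw [interior_Ici] at hz
  have hz' : 0 < z := hz
  have h := wright_sub_one hν0 (by linarith : ν < 1) 1 (-z)
  rw [sub_self, zero_mul] at h
  rw [(hd z).deriv, sub_self, h]
  have h1 := mainardi_nonneg hν0 hν1 hz'
  have h2 : 0 ≤ ν * z * wright (-z) (-ν) (1 - ν) := by positivity
  linarith

/-- Otherwise monotonicity forces the constant value 1 near 0 on the right, against the slope
-1/Γ(1-ν) at 0. -/
theorem wright_one_lt_one (hν0 : 0 < ν) (hν1 : ν < 1 / 2) {z : ℝ} (hz : 0 < z) :
    wright (-z) (-ν) 1 < 1 := by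
  have hanti := antitoneOn_wright_one hν0 hν1
  have h0 : wright (-0) (-ν) 1 = 1 := by rw [neg_zero, wright_zero, Real.Gamma_one, one_div_one]
  by_contra! hle
  have hconst : (fun z => wright (-z) (-ν) 1) =ᶠ[𝓝[Ici 0] 0] fun _ => 1 := by
    filter_upwards [self_mem_nhdsWithin, mem_nhdsWithin_of_mem_nhds (Iio_mem_nhds hz)] with y hy hyz
    refine le_antisymm ?_ ?_
    · exact (hanti self_mem_Ici hy hy).trans_eq h0
    · exact hle.trans (hanti hy hz.le (le_of_lt hyz))
  have hd1 := (hasDerivAt_wright_neg hν0 (by linarith : ν < 1) 1 0).hasDerivWithinAt (s := Ici 0)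
  have hd2 := (hasDerivWithinAt_const (0 : ℝ) (Ici 0) (1 : ℝ)).congr_of_eventuallyEq hconst h0
  have h := (uniqueDiffOn_Ici (0 : ℝ) 0 self_mem_Ici).eq_deriv _ hd1 hd2
  rw [neg_zero, wright_zero] at h
  have := Real.Gamma_pos_of_pos (by linarith : 0 < 1 - ν)
  have : 0 < 1 / Real.Gamma (1 - ν) := by positivity
  linarith

/-- The recurrence at β = 1 + ν merges the right side into one term; in this form the two sides are
monotone in opposite directions, and the Stefan condition can be read off. -/
theorem isSimilarityRoot_iff {α ξ : ℝ} (hν : ν = α / 2) (hν0 : 0 < ν) (hν1 : ν < 1) :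
    IsSimilarityRoot α ξ ↔ 0 < ξ ∧
      2 * ξ * (1 - wright (-(2 * ξ)) (-ν) 1) = wright (-(2 * ξ)) (-ν) ν / ν := by
  have h := wright_sub_one hν0 hν1 (1 + ν) (-(2 * ξ))
  rw [show 1 + ν - 1 = ν by ring, show 1 + ν - ν = 1 by ring] at h
  unfold IsSimilarityRoot
  rw [show -α / 2 = -ν by rw [hν]; ring, show -2 * ξ = -(2 * ξ) by ring, ← hν, h]
  refine and_congr_right fun _ => ?_
  rw [show (ν * wright (-(2 * ξ)) (-ν) (1 + ν) - ν * -(2 * ξ) * wright (-(2 * ξ)) (-ν) 1) / ν =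
    2 * ξ * wright (-(2 * ξ)) (-ν) 1 + wright (-(2 * ξ)) (-ν) (1 + ν) by field_simp; ring]

theorem existsUnique_similarityRoot {α : ℝ} (hα0 : 0 < α) (hα1 : α < 1) :
    ∃! ξ : ℝ, IsSimilarityRoot α ξ := by
  obtain ⟨ν, hν⟩ : ∃ ν, ν = α / 2 := ⟨_, rfl⟩
  have hν0 : 0 < ν := by linarith
  have hν1 : ν < 1 / 2 := by linarith
  have hν1' : ν < 1 := by linarith
  simp only [isSimilarityRoot_iff hν hν0 hν1']
  have hW1 := antitoneOn_wright_one hν0 hν1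
  have hWν := antitoneOn_wright_self hν0 hν1
  set f : ℝ → ℝ := fun x => 2 * x * (1 - wright (-(2 * x)) (-ν) 1) -
    wright (-(2 * x)) (-ν) ν / ν with hf
  have hG := Real.Gamma_pos_of_pos hν0
  have hcont : Continuous f := by
    have h1 := (continuous_wright hν0 hν1' 1).comp (by fun_prop : Continuous fun x : ℝ => -(2 * x))
    have h2 := (continuous_wright hν0 hν1' ν).comp (by fun_prop : Continuous fun x : ℝ => -(2 * x))
    simp only [Function.comp_def] at h1 h2
    fun_prop
  have hstrict : ∀ x y : ℝ, 0 < x → x < y → f x < f y := by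
    intro x y hx hxy
    have h1 : wright (-(2 * y)) (-ν) 1 ≤ wright (-(2 * x)) (-ν) 1 :=
      hW1 (by simpa using hx.le) (by simpa using (hx.trans hxy).le) (by linarith)
    have h2 : wright (-(2 * y)) (-ν) ν ≤ wright (-(2 * x)) (-ν) ν :=
      hWν (by simpa using hx.le) (by simpa using (hx.trans hxy).le) (by linarith)
    have h3 := wright_one_lt_one hν0 hν1 (z := 2 * x) (by linarith)
    have h4 : wright (-(2 * y)) (-ν) ν / ν ≤ wright (-(2 * x)) (-ν) ν / ν := by gcongr
    simp only [hf]
    nlinarith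
  have hf0 : f 0 < 0 := by
    simp only [hf, mul_zero, neg_zero, zero_mul, zero_sub, wright_zero, Left.neg_neg_iff]
    positivity
  obtain ⟨X, hX0, hX⟩ : ∃ X : ℝ, 0 < X ∧ 0 < f X := by
    have h3 := wright_one_lt_one hν0 hν1 (z := 2) (by linarith)
    set δ := 1 - wright (-2) (-ν) 1 with hδ
    have hδ0 : 0 < δ := by linarith
    set B := 1 / Real.Gamma ν / ν with hB
    have hB0 : 0 < B := by positivity
    -- For X ≥ 1 monotonicity gives f X ≥ 2Xδ - B, which at this X equals 2δ + B > 0.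
    refine ⟨1 + B / δ, by positivity, ?_⟩
    have hXpos : 0 < 1 + B / δ := by positivity
    have hle1 : 1 ≤ 1 + B / δ := by
      have : 0 < B / δ := by positivity
      linarith
    have h1 : wright (-(2 * (1 + B / δ))) (-ν) 1 ≤ wright (-2) (-ν) 1 :=
      hW1 (by simp) (by simpa using hXpos.le) (by linarith)
    have h2 : wright (-(2 * (1 + B / δ))) (-ν) ν ≤ 1 / Real.Gamma ν := by
      have := hWν self_mem_Ici (by simpa using hXpos.le : 2 * (1 + B / δ) ∈ Ici (0 : ℝ))
        (by positivity)
      simpa [wright_zero] using this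
    have h4 : wright (-(2 * (1 + B / δ))) (-ν) ν / ν ≤ B := by
      rw [hB]; gcongr
    have h5 : 2 * (1 + B / δ) * δ ≤ 2 * (1 + B / δ) * (1 - wright (-(2 * (1 + B / δ))) (-ν) 1) := by
      refine mul_le_mul_of_nonneg_left (by linarith) (by positivity)
    have h6 : 2 * (1 + B / δ) * δ = 2 * δ + 2 * B := by field_simp
    simp only [hf]
    linarith
  obtain ⟨ξ, hξ, hξ0⟩ := intermediate_value_Icc hX0.le hcont.continuousOn ⟨hf0.le, hX.le⟩
  have hξpos : 0 < ξ := by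
    rcases hξ.1.eq_or_lt with h | h
    · rw [← h] at hξ0; exact absurd hξ0 hf0.ne
    · exact h
  refine ⟨ξ, ⟨hξpos, sub_eq_zero.1 hξ0⟩, fun η hη => ?_⟩
  have hη0 : f η = 0 := sub_eq_zero.2 hη.2
  rcases lt_trichotomy η ξ with h | h | h
  · have := hstrict _ _ hη.1 h
    linarith
  · exact h
  · have := hstrict _ _ hξpos h
    linarith

end Root

/-! ### Absolute continuity from derivative bounds -/

section Lipschitz

/-- A function with bounded derivative on an open interval is absolutely continuous there. -/
theorem acOpenInterval_of_hasDerivAt {f f' : ℝ → ℝ} {a b C : ℝ}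
    (hf : ∀ t ∈ Ioo a b, HasDerivAt f (f' t) t) (hC : ∀ t ∈ Ioo a b, |f' t| ≤ C) :
    ACOpenInterval f a b := by
  have hlip := (convex_Ioo a b).lipschitzOnWith_of_nnnorm_hasDerivWithin_le (C := C.toNNReal)
    (fun t ht => (hf t ht).hasDerivWithinAt) fun t ht => by
      rw [← NNReal.coe_le_coe, coe_nnnorm]
      exact (hC t ht).trans (Real.le_coe_toNNReal C)
  obtain ⟨g, hg, hfg⟩ := hlip.extend_real
  exact ⟨g, hg.lipschitzOnWith.absolutelyContinuousOnInterval, hfg.symm⟩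

theorem absolutelyContinuousOnInterval_of_hasDerivAt {f f' : ℝ → ℝ} {c d : ℝ} (hcd : c ≤ d)
    (hf : ∀ t ∈ Icc c d, HasDerivAt f (f' t) t) (hf' : ContinuousOn f' (Icc c d)) :
    AbsolutelyContinuousOnInterval f c d := by
  obtain ⟨C, hC⟩ := isCompact_Icc.exists_bound_of_continuousOn hf'
  have hlip := (convex_Icc c d).lipschitzOnWith_of_nnnorm_hasDerivWithin_le (C := C.toNNReal)
    (fun t ht => (hf t ht).hasDerivWithinAt) fun t ht => by
      rw [← NNReal.coe_le_coe, coe_nnnorm]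
      exact (hC t ht).trans (Real.le_coe_toNNReal C)
  rw [← uIcc_of_le hcd] at hlip
  exact hlip.absolutelyContinuousOnInterval

end Lipschitz

/-! ### Verification of the similarity solution -/

section Solution

variable {α ν ξ T : ℝ}

/-- The amplitude of the similarity temperature. -/
noncomputable def similarityAmplitude (ν ξ : ℝ) : ℝ := 1 / (1 - wright (-(2 * ξ)) (-ν) 1)

theorem similarityTemp_eq (hν : ν = α / 2) (ξ x t : ℝ) :
    similarityTemp α ξ x t = 1 - similarityAmplitude ν ξ * (1 - wrightKernel ν 1 x t) := by
  unfold similarityTemp similarityAmplitude wrightKernel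
  rw [show -α / 2 = -ν by rw [hν]; ring, show -2 * ξ = -(2 * ξ) by ring, ← hν, sub_self,
    Real.rpow_zero, one_mul]

theorem similarityFront_mono (hα0 : 0 < α) (hξ : 0 < ξ) :
    MonotoneOn (similarityFront α ξ) (Ici 0) := by
  intro a ha b _ hab
  have : a ^ (α / 2) ≤ b ^ (α / 2) := Real.rpow_le_rpow ha hab (by linarith)
  unfold similarityFront
  gcongr

theorem frontMax_similarityFront (hα0 : 0 < α) (hξ : 0 < ξ) (hT : 0 < T) :
    frontMax (similarityFront α ξ) T = similarityFront α ξ T := by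
  refine IsGreatest.csSup_eq ⟨⟨T, ⟨hT.le, le_rfl⟩, rfl⟩, ?_⟩
  rintro _ ⟨t, ht, rfl⟩
  exact similarityFront_mono hα0 hξ ht.1 hT.le ht.2

theorem similarityFront_pos (hξ : 0 < ξ) {t : ℝ} (ht : 0 < t) : 0 < similarityFront α ξ t := by
  unfold similarityFront
  positivity

theorem hasDerivAt_similarityTemp_space (hν : ν = α / 2) (hν0 : 0 < ν) (hν1 : ν < 1) (ξ x : ℝ)
    {t : ℝ} (ht : 0 < t) :
    HasDerivAt (fun y => similarityTemp α ξ y t)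
      (-similarityAmplitude ν ξ * wrightKernel ν (1 - ν) x t) x := by
  simp only [similarityTemp_eq hν]
  have h := (((hasDerivAt_wrightKernel_space hν0 hν1 1 x ht).const_sub 1).const_mul
    (similarityAmplitude ν ξ)).const_sub 1
  exact h.congr_deriv (by ring)

theorem spaceDeriv_similarityTemp (hν : ν = α / 2) (hν0 : 0 < ν) (hν1 : ν < 1) (ξ : ℝ) {b x t : ℝ}
    (hb : 0 < b) (hx : x ∈ Icc 0 b) (ht : 0 < t) :
    spaceDeriv b (similarityTemp α ξ) x t =
      -similarityAmplitude ν ξ * wrightKernel ν (1 - ν) x t :=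
  (hasDerivAt_similarityTemp_space hν hν0 hν1 ξ x ht).hasDerivWithinAt.derivWithin
    (uniqueDiffOn_Icc hb x hx)

theorem hasDerivAt_spaceDeriv_similarityTemp (hν : ν = α / 2) (hν0 : 0 < ν) (hν1 : ν < 1) (ξ : ℝ)
    {b x t : ℝ} (hb : 0 < b) (hx : x ∈ Ioo 0 b) (ht : 0 < t) :
    HasDerivAt (fun y => spaceDeriv b (similarityTemp α ξ) y t)
      (similarityAmplitude ν ξ * wrightKernel ν (1 - ν - ν) x t) x := by
  have h := (hasDerivAt_wrightKernel_space hν0 hν1 (1 - ν) x ht).const_mul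
    (-similarityAmplitude ν ξ)
  refine (h.congr_deriv (by ring)).congr_of_eventuallyEq ?_
  filter_upwards [isOpen_Ioo.mem_nhds hx] with y hy
  exact spaceDeriv_similarityTemp hν hν0 hν1 ξ hb ⟨hy.1.le, hy.2.le⟩ ht

theorem hasDerivAt_spaceDeriv_similarityTemp_time (hν : ν = α / 2) (hν0 : 0 < ν) (hν1 : ν < 1)
    (ξ : ℝ) {b x t : ℝ} (hb : 0 < b) (hx : x ∈ Icc 0 b) (ht : 0 < t) :
    HasDerivAt (spaceDeriv b (similarityTemp α ξ) x)
      (-similarityAmplitude ν ξ * wrightKernel ν (-ν) x t) t := by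
  have h := (hasDerivAt_wrightKernel_time hν0 hν1 (1 - ν) x ht).const_mul
    (-similarityAmplitude ν ξ)
  rw [show 1 - ν - 1 = -ν by ring] at h
  refine h.congr_of_eventuallyEq ?_
  filter_upwards [lt_mem_nhds ht] with s hs
  exact spaceDeriv_similarityTemp hν hν0 hν1 ξ hb hx hs

/-- The fractional flux of the similarity temperature. -/
theorem hasDerivWithinAt_rlIntegral_similarityTemp (hν : ν = α / 2) (hν0 : 0 < ν)
    (hν1 : ν < 1 / 2) (ξ : ℝ) {b x t : ℝ} (hb : 0 < b) (hx : x ∈ Ioc 0 b) (ht : t ∈ Ioc 0 T) :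
    HasDerivWithinAt (rlIntegral α (spaceDeriv b (similarityTemp α ξ) x))
      (-similarityAmplitude ν ξ * wrightKernel ν ν x t) (Icc 0 T) t := by
  have hν1' : ν < 1 := by linarith
  have hα : 1 - ν + α - 1 = ν := by rw [hν]; ring
  obtain ⟨C, hC⟩ := exists_abs_wrightKernel_le (β := ν) hν0 hν1 hν1' hx.1
  have h := ((hasDerivAt_integral_of_bounded
    (continuousOn_wrightKernel_time hν0 hν1' ν x) hC ht.1).const_mul
    (-similarityAmplitude ν ξ)).hasDerivWithinAt (s := Icc 0 T)
  have heq : ∀ r : ℝ, 0 ≤ r → rlIntegral α (spaceDeriv b (similarityTemp α ξ) x) r =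
      -similarityAmplitude ν ξ * ∫ τ in (0 : ℝ)..r, wrightKernel ν ν x τ := by
    intro r hr
    -- The derivative is taken within [0, T], so the identity is also required at r = 0, where both
    -- integrals are empty.
    rcases hr.eq_or_lt with rfl | hr
    · simp [rlIntegral]
    · have h1 := rlIntegral_wrightKernel (β := 1 - ν) (γ := α) hν0 hν1 (by linarith) (by linarith)
        (by linarith) (by rw [hα]; exact hν0) (by rw [hα]; exact hν1') hx.1 hr
      rw [hα] at h1
      rw [← h1]
      unfold rlIntegral
      have h2 : ∫ τ in (0 : ℝ)..r, (r - τ) ^ (α - 1) * spaceDeriv b (similarityTemp α ξ) x τ =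
          -similarityAmplitude ν ξ *
            ∫ τ in (0 : ℝ)..r, (r - τ) ^ (α - 1) * wrightKernel ν (1 - ν) x τ := by
        rw [← intervalIntegral.integral_const_mul]
        refine intervalIntegral.integral_congr_ae (Eventually.of_forall fun τ hτ => ?_)
        rw [uIoc_of_le hr.le] at hτ
        rw [spaceDeriv_similarityTemp hν hν0 hν1' ξ hb ⟨hx.1.le, hx.2⟩ hτ.1]
        ring
      rw [h2]
      ring
  exact h.congr (fun r hr => heq r hr.1) (heq t ht.1.le)

theorem rlDeriv_similarityTemp (hν : ν = α / 2) (hν0 : 0 < ν) (hν1 : ν < 1 / 2) (ξ : ℝ)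
    {b x t : ℝ} (hb : 0 < b) (hx : x ∈ Ioc 0 b) (ht : t ∈ Ioc 0 T) :
    rlDeriv T (1 - α) (spaceDeriv b (similarityTemp α ξ) x) t =
      -similarityAmplitude ν ξ * wrightKernel ν ν x t := by
  unfold rlDeriv
  rw [sub_sub_cancel]
  exact (hasDerivWithinAt_rlIntegral_similarityTemp hν hν0 hν1 ξ hb hx ht).derivWithin
    (uniqueDiffOn_Icc (ht.1.trans_le ht.2) t ⟨ht.1.le, ht.2⟩)

theorem continuousOn_spaceDeriv_similarityTemp_time (hν : ν = α / 2) (hν0 : 0 < ν) (hν1 : ν < 1)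
    (ξ : ℝ) {b x : ℝ} (hb : 0 < b) (hx : x ∈ Icc 0 b) :
    ContinuousOn (spaceDeriv b (similarityTemp α ξ) x) (Ioi 0) := fun _ ht =>
  (hasDerivAt_spaceDeriv_similarityTemp_time hν hν0 hν1 ξ hb hx
    ht).continuousAt.continuousWithinAt

theorem exists_abs_spaceDeriv_similarityTemp_le (hν : ν = α / 2) (hν0 : 0 < ν) (hν1 : ν < 1 / 2)
    (ξ : ℝ) {b x : ℝ} (hb : 0 < b) (hx : x ∈ Ioc 0 b) :
    ∃ C : ℝ, ∀ t : ℝ, 0 < t → |spaceDeriv b (similarityTemp α ξ) x t| ≤ C := by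
  obtain ⟨C, hC⟩ := exists_abs_wrightKernel_le (β := 1 - ν) hν0 hν1 (by linarith) hx.1
  refine ⟨|similarityAmplitude ν ξ| * C, fun t ht => ?_⟩
  rw [spaceDeriv_similarityTemp hν hν0 (by linarith) ξ hb ⟨hx.1.le, hx.2⟩ ht, abs_mul, abs_neg]
  exact mul_le_mul_of_nonneg_left (hC t ht) (abs_nonneg _)

theorem rlDifferentiableAt_similarityTemp (hν : ν = α / 2) (hν0 : 0 < ν) (hν1 : ν < 1 / 2) (ξ : ℝ)
    {b x t : ℝ} (hb : 0 < b) (hx : x ∈ Ioc 0 b) (ht : t ∈ Ioc 0 T) :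
    RLDifferentiableAt T (1 - α) (spaceDeriv b (similarityTemp α ξ) x) t := by
  unfold RLDifferentiableAt
  rw [sub_sub_cancel]
  refine ⟨fun r hr => ?_, (hasDerivWithinAt_rlIntegral_similarityTemp hν hν0 hν1 ξ hb hx
    ht).differentiableWithinAt⟩
  obtain ⟨C, hC⟩ := exists_abs_spaceDeriv_similarityTemp_le hν hν0 hν1 ξ hb hx
  exact intervalIntegrable_bounded_mul hr.1.le
    (continuousOn_spaceDeriv_similarityTemp_time hν hν0 (by linarith) ξ hb ⟨hx.1.le, hx.2⟩) hC
    (intervalIntegrable_sub_rpow (by linarith) r)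

/-- For x > 0 the derivative is bounded. At x = 0 it is a multiple of t^(-ν), singular but
integrable because ν < 1. -/
theorem integrableOn_spaceDeriv_similarityTemp (hν : ν = α / 2) (hν0 : 0 < ν) (hν1 : ν < 1 / 2)
    (ξ : ℝ) {b x : ℝ} (hb : 0 < b) (hx : x ∈ Icc 0 b) (hT : 0 < T) :
    IntegrableOn (spaceDeriv b (similarityTemp α ξ) x) (Ioo 0 T) := by
  rw [← intervalIntegrable_iff_integrableOn_Ioo_of_le hT.le]
  rcases hx.1.eq_or_lt with h0 | h0
  · have h := (intervalIntegral.intervalIntegrable_rpow' (a := 0) (b := T) (r := -ν)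
      (by linarith)).const_mul (-similarityAmplitude ν ξ * (1 / Real.Gamma (1 - ν)))
    refine h.congr fun t ht => ?_
    rw [uIoc_of_le hT.le] at ht
    rw [spaceDeriv_similarityTemp hν hν0 (by linarith) ξ hb hx ht.1, ← h0, wrightKernel, zero_div,
      neg_zero, wright_zero, show 1 - ν - 1 = -ν by ring]
    ring
  · obtain ⟨C, hC⟩ := exists_abs_spaceDeriv_similarityTemp_le hν hν0 hν1 ξ hb ⟨h0, hx.2⟩
    exact intervalIntegrable_of_bounded hT.le
      (continuousOn_spaceDeriv_similarityTemp_time hν hν0 (by linarith) ξ hb hx) hC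

theorem similarityAmplitude_pos (hν0 : 0 < ν) (hν1 : ν < 1 / 2) (hξ : 0 < ξ) :
    0 < similarityAmplitude ν ξ := by
  have := wright_one_lt_one hν0 hν1 (z := 2 * ξ) (by linarith)
  exact one_div_pos.2 (by linarith)

/-- Up to the front x/t^ν lies in [0, 2ξ], where W(-z, -ν, 1) decreases from 1 to its value at 2ξ.
This yields the bounds at the origin, where u has no continuous extension. -/
theorem similarityTemp_mem_Icc (hν : ν = α / 2) (hν0 : 0 < ν) (hν1 : ν < 1 / 2) (hξ : 0 < ξ)
    {x t : ℝ} (ht : 0 < t) (hx0 : 0 ≤ x) (hx : x ≤ similarityFront α ξ t) :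
    similarityTemp α ξ x t ∈ Icc 0 1 := by
  have hA := similarityAmplitude_pos hν0 hν1 hξ
  have hanti := antitoneOn_wright_one hν0 hν1
  have hz0 : 0 ≤ x / t ^ ν := by positivity
  have hz1 : x / t ^ ν ≤ 2 * ξ := by
    rw [div_le_iff₀ (by positivity), hν]
    exact hx
  have h1 : wright (-(x / t ^ ν)) (-ν) 1 ≤ 1 := by
    simpa [wright_zero] using hanti self_mem_Ici hz0 hz0
  have h2 : wright (-(2 * ξ)) (-ν) 1 ≤ wright (-(x / t ^ ν)) (-ν) 1 :=
    hanti hz0 (by simpa using hξ.le) hz1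
  have h3 : similarityAmplitude ν ξ * (1 - wright (-(2 * ξ)) (-ν) 1) = 1 := by
    have := wright_one_lt_one hν0 hν1 (z := 2 * ξ) (by linarith)
    exact one_div_mul_cancel (by linarith)
  rw [similarityTemp_eq hν, wrightKernel, sub_self, Real.rpow_zero, one_mul]
  constructor
  · nlinarith
  · nlinarith

/-- As s(0) = 0, the bottom part of the parabolic boundary is the origin alone, so removing it
leaves only t > 0. -/
theorem similarity_domain (hα0 : 0 < α) (hξ : 0 < ξ) {p : ℝ × ℝ}
    (hp : p ∈ (stefanRegion (similarityFront α ξ) T ∪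
      stefanParabolicBoundary (similarityFront α ξ) T) \ {(0, 0)}) :
    0 < p.2 ∧ 0 ≤ p.1 ∧ p.1 ≤ similarityFront α ξ p.2 := by
  obtain ⟨hp, hne⟩ := hp
  rcases hp with ⟨h1, h2, h3, _⟩ | (⟨h1, h2, _⟩ | ⟨h1, h2, _⟩) | ⟨h1, h2, h3⟩
  · exact ⟨h3, h1.le, h2.le⟩
  · exact ⟨h2, h1.ge, h1.le.trans (similarityFront_pos hξ h2).le⟩
  · exact ⟨h2, h1 ▸ (similarityFront_pos hξ h2).le, h1.le⟩
  · have h0 : similarityFront α ξ 0 = 0 := by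
      rw [similarityFront, Real.zero_rpow (by linarith), mul_zero]
    rw [h0] at h3
    exact absurd (Prod.ext (le_antisymm h3 h2) h1) hne

theorem isFractionalStefanSolution_similarity (hα0 : 0 < α) (hα1 : α < 1)
    (hroot : IsSimilarityRoot α ξ) (hT : 0 < T) :
    IsFractionalStefanSolution α T (similarityTemp α ξ) (similarityFront α ξ) := by
  obtain ⟨ν, hν⟩ : ∃ ν, ν = α / 2 := ⟨_, rfl⟩
  have hν0 : 0 < ν := by linarith
  have hν1 : ν < 1 / 2 := by linarith
  have hν1' : ν < 1 := by linarith
  obtain ⟨hξ, hroot⟩ := (isSimilarityRoot_iff hν hν0 hν1').1 hroot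
  have hlt := wright_one_lt_one hν0 hν1 (z := 2 * ξ) (by linarith)
  have hAmp : similarityAmplitude ν ξ * (1 - wright (-(2 * ξ)) (-ν) 1) = 1 :=
    one_div_mul_cancel (by linarith)
  set b := frontMax (similarityFront α ξ) T with hbdef
  have hbT : b = similarityFront α ξ T := frontMax_similarityFront hα0 hξ hT
  have hb : 0 < b := hbT ▸ similarityFront_pos hξ hT
  have hsb : ∀ t ∈ Ioc 0 T, similarityFront α ξ t ≤ b := fun t ht =>
    hbT ▸ similarityFront_mono hα0 hξ ht.1.le hT.le ht.2
  have hregion : ∀ p ∈ stefanRegion (similarityFront α ξ) T,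
      p.1 ∈ Ioo 0 b ∧ p.2 ∈ Ioc 0 T := fun p hp =>
    ⟨⟨hp.1, hp.2.1.trans_le (hsb _ ⟨hp.2.2.1, hp.2.2.2⟩)⟩, hp.2.2.1, hp.2.2.2⟩
  have hfront : ∀ t ∈ Ioc 0 T, similarityFront α ξ t ∈ Ioc 0 b := fun t ht =>
    ⟨similarityFront_pos hξ ht.1, hsb t ht⟩
  have hfrontz : ∀ t : ℝ, 0 < t → similarityFront α ξ t / t ^ ν = 2 * ξ := fun t ht => by
    rw [similarityFront, ← hν, mul_div_cancel_right₀ _ (by positivity)]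
  have hflux : ∀ x t : ℝ, x ∈ Ioo 0 b → t ∈ Ioc 0 T →
      HasDerivAt (fun y => rlDeriv T (1 - α) (spaceDeriv b (similarityTemp α ξ) y) t)
        (similarityAmplitude ν ξ * wrightKernel ν 0 x t) x := by
    intro x t hx ht
    have h := (hasDerivAt_wrightKernel_space hν0 hν1' ν x ht.1).const_mul
      (-similarityAmplitude ν ξ)
    rw [sub_self] at h
    refine (h.congr_deriv (by ring)).congr_of_eventuallyEq ?_
    filter_upwards [isOpen_Ioo.mem_nhds hx] with y hy
    exact rlDeriv_similarityTemp hν hν0 hν1 ξ hb ⟨hy.1, hy.2.le⟩ ht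
  have hcont : ∀ β : ℝ, ContinuousOn (fun p : ℝ × ℝ => wrightKernel ν β p.1 p.2)
      (stefanRegion (similarityFront α ξ) T) := fun β =>
    (continuousOn_wrightKernel hν0 hν1' β).mono fun p hp => (hregion p hp).2.1
  have hbounds : ∀ᶠ p : ℝ × ℝ in 𝓝[(stefanRegion (similarityFront α ξ) T ∪
      stefanParabolicBoundary (similarityFront α ξ) T) \ {(0, 0)}] (0, 0),
      similarityTemp α ξ p.1 p.2 ∈ Icc 0 1 := by
    filter_upwards [self_mem_nhdsWithin] with p hp
    obtain ⟨h1, h2, h3⟩ := similarity_domain hα0 hξ hp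
    exact similarityTemp_mem_Icc hν hν0 hν1 hξ h1 h2 h3
  have hxIoo : ∀ x t : ℝ, 0 < x → x < similarityFront α ξ t → 0 < t → t < T → x ∈ Ioo 0 b :=
    fun x t h1 h2 h3 h4 => ⟨h1, h2.trans_le (hsb t ⟨h3, h4.le⟩)⟩
  exact
  { front_continuousOn := by
      unfold similarityFront
      exact (continuous_const.mul (Real.continuous_rpow_const (by linarith))).continuousOn
    front_contDiffOn := by
      unfold similarityFront
      intro t ht
      exact (contDiffAt_const.mul
        (Real.contDiffAt_rpow_const_of_ne ht.1.ne')).contDiffWithinAt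
    space_differentiable := fun x _ t ht =>
      (hasDerivAt_similarityTemp_space hν hν0 hν1' ξ x
        ht.1).differentiableAt.differentiableWithinAt
    spaceDeriv_continuousOn :=
      (continuousOn_const.mul (hcont (1 - ν))).congr fun p hp =>
        spaceDeriv_similarityTemp hν hν0 hν1' ξ hb (Ioo_subset_Icc_self (hregion p hp).1)
          (hregion p hp).2.1
    spaceDeriv_differentiableAt := fun p hp =>
      (hasDerivAt_spaceDeriv_similarityTemp hν hν0 hν1' ξ hb (hregion p hp).1
        (hregion p hp).2.1).differentiableAt
    spaceDeriv_deriv_continuousOn :=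
      (continuousOn_const.mul (hcont (1 - ν - ν))).congr fun p hp =>
        (hasDerivAt_spaceDeriv_similarityTemp hν hν0 hν1' ξ hb (hregion p hp).1
          (hregion p hp).2.1).deriv
    -- The time derivative of u_x is a multiple of K_(-ν), bounded in t for each fixed x > 0, so
    -- u_x(x, ·) is Lipschitz.
    spaceDeriv_ac := fun x hx => by
      obtain ⟨C, hC⟩ := exists_abs_wrightKernel_le (β := -ν) hν0 hν1 (by linarith) hx.1
      refine acOpenInterval_of_hasDerivAt (C := |similarityAmplitude ν ξ| * C)
        (fun t ht => hasDerivAt_spaceDeriv_similarityTemp_time hν hν0 hν1' ξ hb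
          ⟨hx.1.le, hx.2⟩ ht.1) fun t ht => ?_
      rw [abs_mul, abs_neg]
      exact mul_le_mul_of_nonneg_left (hC t ht.1) (abs_nonneg _)
    -- At x = 0 the bound fails near t = 0; away from 0 the derivative is continuous, hence bounded
    -- on compact intervals.
    spaceDeriv_ac_face := fun c d hc hcd _ =>
      absolutelyContinuousOnInterval_of_hasDerivAt hcd.le
        (fun t ht => hasDerivAt_spaceDeriv_similarityTemp_time hν hν0 hν1' ξ hb
          ⟨le_rfl, hb.le⟩ (hc.trans_le ht.1))
        (continuousOn_const.mul ((continuousOn_wrightKernel_time hν0 hν1' (-ν) 0).mono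
          fun t ht => hc.trans_le ht.1))
    spaceDeriv_integrable := fun x hx =>
      integrableOn_spaceDeriv_similarityTemp hν hν0 hν1 ξ hb hx hT
    temp_continuousOn := by
      simp only [similarityTemp_eq hν]
      exact continuousOn_const.sub (continuousOn_const.mul (continuousOn_const.sub
        ((continuousOn_wrightKernel hν0 hν1' 1).mono fun p hp =>
          (similarity_domain hα0 hξ hp).1)))
    temp_liminf := le_liminf_of_le (h := hbounds.mono fun p hp => EReal.coe_nonneg.2 hp.1)
    temp_limsup := by
      refine lt_of_le_of_lt (limsup_le_of_le (a := (1 : EReal))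
        (h := hbounds.mono fun p hp => ?_)) (EReal.coe_lt_top 1)
      exact EReal.coe_le_coe_iff.2 hp.2
    rl_exists := fun p hp =>
      rlDifferentiableAt_similarityTemp hν hν0 hν1 ξ hb
        (Ioo_subset_Ioc_self (hregion p hp).1) (hregion p hp).2
    rl_exists_front := fun t ht =>
      rlDifferentiableAt_similarityTemp hν hν0 hν1 ξ hb (hfront t ht) ht
    flux_differentiableAt := fun x t h1 h2 h3 h4 =>
      (hflux x t (hxIoo x t h1 h2 h3 h4) ⟨h3, h4.le⟩).differentiableAt
    diffusion := fun x t h1 h2 h3 h4 => by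
      rw [(hflux x t (hxIoo x t h1 h2 h3 h4) ⟨h3, h4.le⟩).deriv]
      simp only [similarityTemp_eq hν]
      have h := (((hasDerivAt_wrightKernel_time hν0 hν1' 1 x h3).const_sub 1).const_mul
        (similarityAmplitude ν ξ)).const_sub 1
      rw [sub_self] at h
      exact h.congr_deriv (by ring)
    fixed_face := fun t _ => by
      rw [similarityTemp_eq hν, wrightKernel, zero_div, neg_zero, wright_zero, sub_self,
        Real.rpow_zero, Real.Gamma_one]
      ring
    free_boundary := fun t ht => by
      rw [similarityTemp_eq hν, wrightKernel, hfrontz t ht.1, sub_self, Real.rpow_zero, one_mul,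
        hAmp, sub_self]
    front_zero := by
      rw [similarityFront, Real.zero_rpow (by linarith), mul_zero]
    stefan_condition := fun t ht => by
      rw [rlDeriv_similarityTemp hν hν0 hν1 ξ hb (hfront t ht) ht, wrightKernel, hfrontz t ht.1]
      have h := ((Real.hasDerivAt_rpow_const (p := α / 2) (Or.inl ht.1.ne')).const_mul
        (2 * ξ)).hasDerivWithinAt (s := Icc 0 T)
      refine h.congr_deriv ?_
      rw [← hν]
      rw [eq_div_iff hν0.ne'] at hroot
      rw [← hroot]
      -- By the root equation W(-2ξ, -ν, ν) is 2ξν times the reciprocal of the amplitude, so the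
      -- amplitude cancels and 2ξν t^(ν-1) = s'(t) remains.
      linear_combination (-(2 * ξ * ν * t ^ (ν - 1))) * hAmp }

end Solution

theorem mainTheorem3 (α : ℝ) (hα0 : 0 < α) (hα1 : α < 1) :
    (∃! ξ : ℝ, IsSimilarityRoot α ξ) ∧
      ∀ ξ : ℝ, IsSimilarityRoot α ξ → ∀ T : ℝ, 0 < T →
        IsFractionalStefanSolution α T (similarityTemp α ξ) (similarityFront α ξ) :=
  ⟨existsUnique_similarityRoot hα0 hα1, fun _ hξ _ hT =>
    isFractionalStefanSolution_similarity hα0 hα1 hξ hT⟩
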